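/- Let $n\ge 0$ and let $X$ be the complex vector space with basis the symbols $t^je_i$ ($1\le i\le n$, $j\in\mathbb Z$), with the linear operator $t\colon t^je_i\mapsto t^{j+1}e_i$; let $X_0$ be the span of the $t^je_i$ with $j\ge 0$. A *lattice* is a subspace $Y\subseteq X$ with $tY\subseteq Y$ and $t^NX_0\subseteq Y\subseteq t^{-N}X_0$ for some $N\geq 0$. The set $\mathcal G$ of all lattices (the loop Grassmannian of $GL_n$) carries its Zariski topology as an ind-variety: a subset is open iff for all $N,d$ its intersection with $\{Y : t^NX_0\subseteq Y\subseteq t^{-N}X_0,\ \dim (Y/t^NX_0)=d\}$ is Zariski open in this closed subvariety of the Grassmannian of $d$-dimensional subspaces of $t^{-N}X_0/t^NX_0$ (in its Plücker embedding). Subsets of $\mathcal G$ carry the subspace topology. For a set $S$ of columns let $V_S$ be the span of all $t^je_i$ with $i\in S$, $j\in\mathbb Z$, let $V_i=V_{\{i\}}$, and let $\mathrm{Proj}_{V_i}\colon X\to V_i$ be the projection killing all other columns. For a lattice $Y$, let $\delta_i(Y)$ be the largest $j$ with $t^{-j}e_i\in Y$. For $Y$ a lattice, or the intersection of a lattice with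 some $V_S$, let $Y_0$ be the span of all $t^je_i\in Y$ and let $\dim_0Y=\dim(Y/Y_0)$. A *Kostant picture* $\mathbf p$ is a finite collection of loops $L$, each with a left end $\ell$ and a right end $r$, $1\le \ell<r\le n$; several loops may have the same ends. Such a loop passes through the columns $\ell,\dots,r$, and $V_L=V_{\{\ell,\dots,r\}}$. Write $L\subset L'$ ($L'$ encircles $L$) if $\{\ell,\dots,r\}\subsetneq\{\ell',\dots,r'\}$; loops with the same ends are nested, hence totally ordered by $\subset$. Write $L\subseteq L'$ if $L\subset L'$ or $L=L'$. The Kostant picture $\mathbf p(Y)$ of a lattice $Y$ has, for each $\ell<r$, $$\dim_0(Y\cap V_{\{\ell,\dots,r\}})-\dim_0(Y\cap V_{\{\ell+1,\dots,r\}})-\dim_0(Y\cap V_{\{\ell,\dots,r-1\}})+\dim_0(Y\cap V_{\{\ell+1,\dots,r-1\}})$$ loops with ends $\ell,r$. Let $\lambda(Y)_i=\delta_i(Y)+l_i$, where $l_i$ is the number of loops of $\mathbf p(Y)$ with left end $i$. For a Kostant picture $\mathbf p$ and $\lambda\in\mathbb Z^n$, put $M(\mathbf p,\lambda)=\{Y\in\mathcal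 G : \mathbf p(Y)=\mathbf p,\ \lambda(Y)=\lambda\}$. A *$\mathbf p$-flag* $\{Y_L\}_{L\in\mathbf p}$ in $Y$ is given by linearly independent vectors $(y_L)_{L\in\mathbf p}$ with $Y=Y_0\oplus\langle y_L\rangle_{L\in\mathbf p}$ such that $y_L\in V_L$ and $t y_L\in Y_0\oplus\langle y_{L'}\rangle_{L'\subset L}$ for all $L\in\mathbf p$, by putting $Y_L=(Y_0\cap V_L)\oplus\langle y_{L'}\rangle_{L'\subseteq L}$; put also $Y_L^\circ=(Y_0\cap V_L)+\sum_{L'\subset L}Y_{L'}$. The lattice $Y$ is *compatible* to $\mathbf p$ if it has a $\mathbf p$-flag such that $\mathrm{Proj}_{V_i}(Y_L)\ne \mathrm{Proj}_{V_i}(Y_L^\circ)$ for every loop $L$ of $\mathbf p$ and every column $i$ that $L$ passes through. **Proposition.** For every Kostant picture $\mathbf p$ and every $\lambda\in\mathbb Z^n$, the set $M^\dagger(\mathbf p,\lambda)$ of all lattices in $M(\mathbf p,\lambda)$ that are compatible to $\mathbf p$ is a dense Zariski open subset of $M(\mathbf p,\lambda)$. -/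

import Mathlib

namespace LoopGr

noncomputable section

/-! ### The space `X` and the lattice model of the loop Grassmannian of `GL_n` -/

/-- The complex vector space `X` with basis the symbols `t^j e_i`, `i` a column, `j` an integer.
The pair `(i, j)` stands for the symbol `t^j e_i`. -/
abbrev X (n : ℕ) : Type := (Fin n × ℤ) →₀ ℂ

/-- The basis vector `t^j e_i`. -/
def tE {n : ℕ} (i : Fin n) (j : ℤ) : X n := Finsupp.single (i, j) 1

/-- The operator `t`, sending `t^j e_i` to `t^(j+1) e_i`. -/
def tMul (n : ℕ) : X n →ₗ[ℂ] X n :=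
  Finsupp.lmapDomain ℂ ℂ (fun q : Fin n × ℤ => (q.1, q.2 + 1))

/-- The subspace `t^a X_0`, spanned by the `t^j e_i` with `j ≥ a`. -/
def tX0 (n : ℕ) (a : ℤ) : Submodule ℂ (X n) := Finsupp.supported ℂ ℂ {q | a ≤ q.2}

/-- Points of the loop Grassmannian of `GL_n`: the `t`-stable subspaces `Y` of `X` with
`t^N X_0 ⊆ Y ⊆ t^(-N) X_0` for some `N`. -/
@[ext]
structure LoopGrassmannian (n : ℕ) where
  /-- the underlying subspace of `X` -/
  space : Submodule ℂ (X n)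
  t_mem : ∀ y ∈ space, tMul n y ∈ space
  bounded : ∃ N : ℕ, tX0 n N ≤ space ∧ space ≤ tX0 n (-N)

/-! ### The Zariski topology of the loop Grassmannian -/

/-- The index set of the basis `t^j e_i`, `-N ≤ j < N`, of a complement of `t^N X_0`
in `t^(-N) X_0`. -/
def box (n N : ℕ) : Set (Fin n × ℤ) := {q | -(N : ℤ) ≤ q.2 ∧ q.2 < N}

/-- The lattices `Y` with `t^N X_0 ⊆ Y ⊆ t^(-N) X_0` and `dim (Y / t^N X_0) = d`. The space
`Y / t^N X_0` is identified with the intersection of `Y` with the span of the `t^j e_i`,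
`-N ≤ j < N`; thus these lattices form a subset of the Grassmannian of `d`-dimensional subspaces
of the `2nN`-dimensional space `t^(-N) X_0 / t^N X_0`. -/
def finitePart (n N d : ℕ) : Set (LoopGrassmannian n) :=
  {Y | tX0 n N ≤ Y.space ∧ Y.space ≤ tX0 n (-N) ∧
    Module.finrank ℂ ↥(Y.space ⊓ Finsupp.supported ℂ ℂ (box n N)) = d}

/-- `v` is a basis of `Y / t^N X_0` (a basis given by linear combinations of the `t^j e_i`,
`-N ≤ j < N`). -/
def IsFrame {n : ℕ} (N : ℕ) {d : ℕ} (Y : LoopGrassmannian n) (v : Fin d → X n) : Prop :=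
  LinearIndependent ℂ v ∧
    Submodule.span ℂ (Set.range v) = Y.space ⊓ Finsupp.supported ℂ ℂ (box n N)

/-- The Plücker coordinates of (the span of) `v`: the `d × d` minors of its coordinate matrix,
indexed by `d`-tuples of symbols `t^j e_i`, `-N ≤ j < N`. -/
def plucker {n : ℕ} (N : ℕ) {d : ℕ} (v : Fin d → X n) (q : Fin d → box n N) : ℂ :=
  (Matrix.of fun a b : Fin d => v a (q b : Fin n × ℤ)).det

/-- The set of points of `finitePart n N d` at which the polynomial `f` in the Plücker coordinates
does not vanish. (For `f` homogeneous this does not depend on the frame.) -/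
def basicOpen {n N d : ℕ} (f : MvPolynomial (Fin d → box n N) ℂ) : Set (finitePart n N d) :=
  {Y | ∃ v : Fin d → X n, IsFrame N Y.1 v ∧ MvPolynomial.eval (plucker N v) f ≠ 0}

/-- The Zariski topology on `finitePart n N d`, as a subset of the projective space of its
Plücker coordinates: the open sets are the unions of non-vanishing sets of homogeneous
polynomials in the Plücker coordinates. -/
@[reducible]
def zariskiFinitePart (n N d : ℕ) : TopologicalSpace (finitePart n N d) :=
  TopologicalSpace.generateFrom
    {U | ∃ (k : ℕ) (f : MvPolynomial (Fin d → box n N) ℂ), f.IsHomogeneous k ∧ U = basicOpen f}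

/-- The Zariski topology of the loop Grassmannian, the increasing union of the projective varieties
`{Y | t^N X_0 ⊆ Y ⊆ t^(-N) X_0} = ⋃ d, finitePart n N d`: a set is open if and only if its
intersection with each `finitePart n N d` is Zariski open there. -/
instance zariskiTopology (n : ℕ) : TopologicalSpace (LoopGrassmannian n) :=
  ⨆ (N : ℕ) (d : ℕ), TopologicalSpace.coinduced (fun Y : finitePart n N d => Y.1)
    (zariskiFinitePart n N d)

/-! ### Kostant pictures -/

/-- A positive root of type `A_(n-1)`, given by the left end and the right end of the loop around
it: the loop with ends `ℓ < r` contains the dots `ℓ, …, r - 1`, where dot `i` lies between the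
columns `i` and `i + 1`, and it passes through the columns `ℓ, …, r`. -/
def PosRoot (n : ℕ) : Type := {q : Fin n × Fin n // q.1 < q.2}

/-- A Kostant picture: the number of loops around each positive root. -/
def KostantPicture (n : ℕ) : Type := PosRoot n → ℕ

/-- The loops of a Kostant picture; `⟨α, k⟩` is the `k`-th loop, counted from the inside, among
those drawn around the root `α`. -/
def Loop {n : ℕ} (p : KostantPicture n) : Type := Σ α : PosRoot n, Fin (p α)

/-- The column of the left end of a loop. -/
def Loop.left {n : ℕ} {p : KostantPicture n} (L : Loop p) : Fin n := L.1.1.1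

/-- The column of the right end of a loop. -/
def Loop.right {n : ℕ} {p : KostantPicture n} (L : Loop p) : Fin n := L.1.1.2

/-- `L ⊂ L'`: the loop `L` is encircled by the loop `L'`, that is, either the dots of `L` form a
proper subset of the dots of `L'`, or both contain the same dots and `L` is drawn inside `L'`. -/
def Loop.Encircled {n : ℕ} {p : KostantPicture n} (L L' : Loop p) : Prop :=
  (L.1 ≠ L'.1 ∧ L'.left ≤ L.left ∧ L.right ≤ L'.right) ∨
    (L.1 = L'.1 ∧ (L.2 : ℕ) < (L'.2 : ℕ))

/-- The number `l_i` of loops of `p` whose left end is at column `i`. -/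
def numLeft {n : ℕ} (p : KostantPicture n) (i : Fin n) : ℕ :=
  Nat.card {L : Loop p // L.left = i}

/-! ### The pieces `M(p, λ)` -/

/-- The sum of the columns `V_i`, `i ∈ S`, where `V_i` is the span of the `t^j e_i`, `j ∈ ℤ`. -/
def cols {n : ℕ} (S : Set (Fin n)) : Submodule ℂ (X n) := Finsupp.supported ℂ ℂ {q | q.1 ∈ S}

/-- `Y_0`: the span of the `t^j e_i` that lie in `Y`. -/
def torusPart {n : ℕ} (Y : Submodule ℂ (X n)) : Submodule ℂ (X n) :=
  Submodule.span ℂ {x | (∃ i j, x = tE i j) ∧ x ∈ Y}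

/-- `dim_0 Y = dim (Y / Y_0)`, with `Y / Y_0` taken as a subspace of `X / Y_0`. -/
def dim0 {n : ℕ} (Y : Submodule ℂ (X n)) : ℕ :=
  Module.finrank ℂ ↥(Y.map (torusPart Y).mkQ)

/-- The number `n_L` of loops around the root `α = (ℓ, r)` in the Kostant picture of `Y`:
`dim_0 (Y ∩ V_[ℓ..r]) - dim_0 (Y ∩ V_[ℓ+1..r]) - dim_0 (Y ∩ V_[ℓ..r-1])
+ dim_0 (Y ∩ V_[ℓ+1..r-1])`. (For a single column, `dim_0` is zero.) -/
def loopCount {n : ℕ} (Y : LoopGrassmannian n) (α : PosRoot n) : ℤ :=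
  dim0 (Y.space ⊓ cols (Set.Icc α.1.1 α.1.2)) - dim0 (Y.space ⊓ cols (Set.Ioc α.1.1 α.1.2))
    - dim0 (Y.space ⊓ cols (Set.Ico α.1.1 α.1.2)) + dim0 (Y.space ⊓ cols (Set.Ioo α.1.1 α.1.2))

/-- `δ_i(Y) = m`: the largest `j` with `t^(-j) e_i ∈ Y` is `m`. -/
def IsDelta {n : ℕ} (Y : LoopGrassmannian n) (i : Fin n) (m : ℤ) : Prop :=
  IsGreatest {j : ℤ | tE i (-j) ∈ Y.space} m

/-- `M(p, λ)`: the lattices `Y` with Kostant picture `p(Y) = p` and with coweight `λ(Y) = λ`,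
where `λ(Y)_i = δ_i(Y) + l_i`. -/
def piece {n : ℕ} (p : KostantPicture n) (lam : Fin n → ℤ) : Set (LoopGrassmannian n) :=
  {Y | (∀ α, loopCount Y α = p α) ∧
    ∃ δ : Fin n → ℤ, (∀ i, IsDelta Y i (δ i)) ∧ ∀ i, lam i = δ i + numLeft p i}

/-! ### Flags and compatibility -/

/-- `V_L`: the sum of the columns the loop `L` passes through. -/
def Loop.V {n : ℕ} {p : KostantPicture n} (L : Loop p) : Submodule ℂ (X n) :=
  cols (Set.Icc L.left L.right)

/-- `y` is a basis of the lattice `Y` (that is, `Y = Y_0 ⊕ ⟨y_L⟩` with the `y_L` linearly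
independent), indexed by the loops of `p`, that generates a `p`-flag: `y_L ∈ V_L` and
`t y_L ∈ Y_0 ⊕ ⟨y_L' | L' ⊂ L⟩` for every loop `L`. -/
structure IsFlagBasis {n : ℕ} {p : KostantPicture n} (Y : LoopGrassmannian n)
    (y : Loop p → X n) : Prop where
  linearIndependent : LinearIndependent ℂ y
  disjoint : Disjoint (torusPart Y.space) (Submodule.span ℂ (Set.range y))
  sup_eq : torusPart Y.space ⊔ Submodule.span ℂ (Set.range y) = Y.space
  mem_V : ∀ L, y L ∈ L.V
  t_mem : ∀ L, tMul n (y L) ∈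
    torusPart Y.space ⊔ Submodule.span ℂ (y '' {L' | L'.Encircled L})

/-- The member `Y_L = (Y_0 ∩ V_L) ⊕ ⟨y_L' | L' ⊆ L⟩` of the `p`-flag generated by `y`. -/
def flag {n : ℕ} {p : KostantPicture n} (Y : LoopGrassmannian n) (y : Loop p → X n) (L : Loop p) :
    Submodule ℂ (X n) :=
  (torusPart Y.space ⊓ L.V) ⊔ Submodule.span ℂ (y '' {L' | L' = L ∨ L'.Encircled L})

/-- `Y_L°`: the sum of `Y_0 ∩ V_L` and of the `Y_L'` for the loops `L'` encircled by `L`. -/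
def flagInner {n : ℕ} {p : KostantPicture n} (Y : LoopGrassmannian n) (y : Loop p → X n)
    (L : Loop p) : Submodule ℂ (X n) :=
  (⨆ L' ∈ {L' : Loop p | L'.Encircled L}, flag Y y L') ⊔ (torusPart Y.space ⊓ L.V)

open scoped Classical in
/-- The orthogonal projection of `X` onto the column `V_i`, the `t^j e_i` being an orthogonal
basis. -/
def proj {n : ℕ} (i : Fin n) : X n →ₗ[ℂ] X n :=
  (Finsupp.supported ℂ ℂ {q : Fin n × ℤ | q.1 = i}).subtype ∘ₗ
    Finsupp.restrictDom ℂ ℂ {q : Fin n × ℤ | q.1 = i}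

/-- `Y` is compatible to `p`: it has a `p`-flag such that `Proj_{V_i} Y_L ≠ Proj_{V_i} Y_L°` for
every loop `L` of `p` and every column `i` that `L` passes through. -/
def Compatible {n : ℕ} (Y : LoopGrassmannian n) (p : KostantPicture n) : Prop :=
  ∃ y : Loop p → X n, IsFlagBasis Y y ∧
    ∀ (L : Loop p) (i : Fin n), L.left ≤ i → i ≤ L.right →
      (flag Y y L).map (proj i) ≠ (flagInner Y y L).map (proj i)

/-- `M†(p, λ)`: the lattices in `M(p, λ)` that are compatible to `p`. -/
def compatiblePiece {n : ℕ} (p : KostantPicture n) (lam : Fin n → ℤ) :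
    Set (LoopGrassmannian n) :=
  {Y | Y ∈ piece p lam ∧ Compatible Y p}

end

end LoopGr

namespace LoopGr

open Filter

/-! ### Minors of matrices with independent rows -/

/-! On a piece the numbers `δ i = lam i - numLeft p i` are fixed, hence so is the torus part. A
lattice is then the sum of this torus part and its finite-dimensional `polarPart`, on which `t`
induces the locally nilpotent operator `shift`. By Möbius inversion over intervals of columns
(`loopCount_eq_iff`), having Kostant picture `p` means that the polar part in each interval has
dimension equal to the number of loops inside it.

Since `t y_L` involves only smaller loops, `y_L` has in column `i` a pole of order at most `height i
L`, the length of a longest chain of loops through `i` ending at `L`. A flag is compatible exactly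
when all these bounds are attained (`IsFlagBasis.map_proj_ne_iff`). This does not depend on the
flag: it says that for each `L` passing through `i` some vector of the polar part in the columns of
`L` has a nonzero coefficient at that extreme symbol (`compatible_iff`).

Openness: the polar parts involved have constant dimension on the piece, so each such nonvanishing
holds near a given lattice. It is enforced by disjointness from a suitable coordinate subspace
(`exists_supported_disjoint`), an open condition on Plücker coordinates
(`isOpen_disjoint_supported`).

Density: lattices of the piece come from structure constants, namely the strictly triangular matrix
of `t` on a flag and the residues of its vectors (`FlagData.exists_lattice_eq`). Join the constants
of a given lattice by a line to those that are all one. Genericity, which keeps the lattice in the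
piece, holds at the first point; all extreme coefficients are positive integers at the second. These
conditions, and membership in a given open neighbourhood of the lattice, are polynomial in the
parameter, so they hold together for all but finitely many parameters. -/

/-- Row rank equals column rank, also for infinitely many columns: independent rows force the
columns to span, and a basis can be extracted from them. -/
theorem exists_det_ne_zero {ι κ : Type*} [Fintype ι] [DecidableEq ι] {v : ι → κ → ℂ}
    (hv : LinearIndependent ℂ v) :
    ∃ q : ι → κ, (Matrix.of fun a b => v a (q b)).det ≠ 0 := by
  have hspan : Submodule.span ℂ (Set.range fun (k : κ) (a : ι) => v a k) = ⊤ := by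
    by_contra hne
    obtain ⟨f, hf0, hf⟩ := Submodule.exists_le_ker_of_lt_top _ (lt_top_iff_ne_top.2 hne)
    refine hf0 (LinearMap.pi_ext' fun a => LinearMap.ext_ring ?_)
    -- A functional killing every column is a linear relation between the rows, with its values on
    -- the standard basis as coefficients.
    have h := Fintype.linearIndependent_iff.1 hv (fun a => f (Pi.single a 1)) (by
      funext k
      have hk : f (fun a => v a k) = 0 :=
        hf (Submodule.subset_span ⟨k, rfl⟩)
      rw [LinearMap.pi_apply_eq_sum_univ f] at hk
      rw [Finset.sum_apply, Pi.zero_apply, ← hk]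
      refine Finset.sum_congr rfl fun a _ => ?_
      rw [Pi.smul_apply, smul_eq_mul, smul_eq_mul, mul_comm]
      congr 2
      funext b
      simp [Pi.single_apply, eq_comm])
    simpa using h a
  obtain ⟨κ', a, -, ha, hli⟩ := exists_linearIndependent' ℂ fun (k : κ) (a : ι) => v a k
  let b := Module.Basis.mk hli (by rw [ha, hspan])
  let e := (Pi.basisFun ℂ ι).indexEquiv b
  refine ⟨fun i => a (e i), ?_⟩
  have h2 : LinearIndependent ℂ (Matrix.of fun i j => v i (a (e j))).col :=
    hli.comp e e.injective
  rw [Matrix.linearIndependent_cols_iff_isUnit, Matrix.isUnit_iff_isUnit_det] at h2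
  exact h2.ne_zero

theorem linearIndependent_of_det_ne_zero {ι κ : Type*} [Fintype ι] [DecidableEq ι] {v : ι → κ → ℂ}
    (q : ι → κ) (h : (Matrix.of fun a b => v a (q b)).det ≠ 0) : LinearIndependent ℂ v := by
  have h2 : LinearIndependent ℂ (Matrix.of fun a b => v a (q b)).row := by
    rw [Matrix.linearIndependent_rows_iff_isUnit, Matrix.isUnit_iff_isUnit_det]
    exact h.isUnit
  exact LinearIndependent.of_comp (LinearMap.funLeft ℂ ℂ q) h2

theorem eventually_eval_ne_zero {P : Polynomial ℂ} {a : ℂ} (h : P.eval a ≠ 0) :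
    ∀ᶠ s in cofinite, P.eval s ≠ 0 := by
  have hP : P ≠ 0 := by rintro rfl; simp at h
  have := P.finite_setOfPred_isRoot hP
  simpa [Filter.eventually_cofinite, Polynomial.IsRoot] using this

/-- A family of vectors with polynomial coordinates that is independent at one parameter is
independent at all but finitely many parameters. -/
theorem eventually_linearIndependent {ι κ : Type*} [Finite ι] (v : ι → κ → Polynomial ℂ) {a : ℂ}
    (h : LinearIndependent ℂ fun i k => (v i k).eval a) :
    ∀ᶠ s in cofinite, LinearIndependent ℂ fun i k => (v i k).eval s := by
  classical
  have := Fintype.ofFinite ι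
  obtain ⟨q, hq⟩ := exists_det_ne_zero h
  have key : ∀ s : ℂ, (Matrix.of fun a b => (v a (q b)).eval s).det =
      (Matrix.of fun a b => v a (q b)).det.eval s := fun s => by
    rw [← Polynomial.coe_evalRingHom, RingHom.map_det]
    rfl
  rw [key] at hq
  filter_upwards [eventually_eval_ne_zero hq] with s hs
  rw [← key] at hs
  exact linearIndependent_of_det_ne_zero q hs

end LoopGr

namespace LoopGr

open Filter Topology

/-! ### Zariski open sets of the loop Grassmannian -/

theorem isOpen_iff_finitePart {n : ℕ} {U : Set (LoopGrassmannian n)} :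
    IsOpen U ↔ ∀ N d : ℕ,
      IsOpen[zariskiFinitePart n N d] {Y : finitePart n N d | Y.1 ∈ U} := by
  simp only [isOpen_iSup_iff, isOpen_coinduced]
  rfl

theorem isOpen_basicOpen_X {n N d : ℕ} (q : Fin d → box n N) :
    IsOpen[zariskiFinitePart n N d] (basicOpen (MvPolynomial.X q)) :=
  TopologicalSpace.isOpen_generateFrom_of_mem ⟨1, _, MvPolynomial.isHomogeneous_X _ _, rfl⟩

theorem mem_basicOpen_X {n N d : ℕ} {q : Fin d → box n N} {Y : finitePart n N d} :
    Y ∈ basicOpen (MvPolynomial.X q) ↔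
      ∃ v : Fin d → X n, IsFrame N Y.1 v ∧ plucker N v q ≠ 0 := by
  simp [basicOpen]

theorem finite_box (n N : ℕ) : (box n N).Finite := by
  have : box n N ⊆ (Set.univ : Set (Fin n)) ×ˢ Set.Ico (-(N : ℤ)) N := by
    rintro ⟨i, j⟩ h
    exact ⟨trivial, h⟩
  exact (Set.finite_univ.prod (Set.finite_Ico _ _)).subset this

instance finiteDimensional_supported {α : Type*} (s : Set α) [Finite s] :
    FiniteDimensional ℂ (Finsupp.supported ℂ ℂ s) :=
  Module.Finite.equiv (Finsupp.supportedEquivFinsupp s).symm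

theorem finiteDimensional_of_le_supported {α : Type*} {s : Set α} (hs : s.Finite)
    {W : Submodule ℂ (α →₀ ℂ)} (hW : W ≤ Finsupp.supported ℂ ℂ s) : FiniteDimensional ℂ W :=
  have : Finite s := hs
  Submodule.finiteDimensional_of_le hW

theorem exists_linearIndependent_span_eq {V : Type*} [AddCommGroup V] [Module ℂ V]
    (W : Submodule ℂ V) [FiniteDimensional ℂ W] {d : ℕ} (hd : Module.finrank ℂ W = d) :
    ∃ v : Fin d → V, LinearIndependent ℂ v ∧ Submodule.span ℂ (Set.range v) = W := by
  let b := Module.finBasisOfFinrankEq ℂ W hd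
  refine ⟨fun a => (b a : V), b.linearIndependent.map' W.subtype W.ker_subtype, ?_⟩
  have := congrArg (Submodule.map W.subtype) b.span_eq
  rw [Submodule.map_span, ← Set.range_comp, Submodule.map_top, Submodule.range_subtype] at this
  exact this

theorem exists_isFrame {n N d : ℕ} (Y : finitePart n N d) :
    ∃ v : Fin d → X n, IsFrame N Y.1 v := by
  obtain ⟨Y, h1, h2, h3⟩ := Y
  have : FiniteDimensional ℂ ↥(Y.space ⊓ Finsupp.supported ℂ ℂ (box n N)) :=
    finiteDimensional_of_le_supported (finite_box n N) inf_le_right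
  exact exists_linearIndependent_span_eq _ h3

/-- A finite-dimensional space of finitely supported functions that meets the functions supported
on `s` in zero has a nonvanishing minor with columns outside `s`. -/
theorem exists_det_ne_zero_of_disjoint {α ι : Type*} [Fintype ι] [DecidableEq ι]
    {v : ι → α →₀ ℂ} (hv : LinearIndependent ℂ v) {s : Set α}
    (hd : Disjoint (Submodule.span ℂ (Set.range v)) (Finsupp.supported ℂ ℂ s)) :
    ∃ q : ι → α, (∀ a, q a ∉ s) ∧ (Matrix.of fun a b => v a (q b)).det ≠ 0 := by
  have h : LinearIndependent ℂ fun a (k : ↥(sᶜ)) => v a k := by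
    let f : (α →₀ ℂ) →ₗ[ℂ] (↥(sᶜ) → ℂ) :=
      LinearMap.funLeft ℂ ℂ Subtype.val ∘ₗ Finsupp.lcoeFun
    refine hv.map (f := f) (hd.mono_right ?_)
    intro x hx
    rw [Finsupp.mem_supported']
    intro k hk
    exact congrFun (LinearMap.mem_ker.1 hx) ⟨k, hk⟩
  obtain ⟨q, hq⟩ := exists_det_ne_zero h
  exact ⟨fun a => q a, fun a => (q a).2, hq⟩

/-- An invertible minor means that a vector of the span is determined by its coordinates in the
chosen columns. -/
theorem eq_zero_of_mem_span_of_det_ne_zero {α ι : Type*} [Fintype ι] [DecidableEq ι]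
    {v : ι → α →₀ ℂ} {q : ι → α} (hq : (Matrix.of fun a b => v a (q b)).det ≠ 0)
    {x : α →₀ ℂ} (hx : x ∈ Submodule.span ℂ (Set.range v)) (h : ∀ a, x (q a) = 0) : x = 0 := by
  obtain ⟨c, rfl⟩ := (Submodule.mem_span_range_iff_exists_fun ℂ).1 hx
  have : Matrix.vecMul c (Matrix.of fun a b => v a (q b)) = 0 := by
    funext b
    have := h b
    simpa [Finsupp.finsetSum_apply, Matrix.vecMul, dotProduct] using this
  rw [Matrix.eq_zero_of_vecMul_eq_zero hq this]
  simp

/-- Disjointness says that restriction to the symbols outside `S` is injective on `Y`, that is, that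
some Plücker coordinate with columns outside `S` is nonzero. This is the only source of open sets in
the openness proof. -/
theorem isOpen_disjoint_supported {n : ℕ} (S : Set (Fin n × ℤ)) :
    IsOpen {Y : LoopGrassmannian n | Disjoint Y.space (Finsupp.supported ℂ ℂ S)} := by
  refine isOpen_iff_finitePart.2 fun N d => ?_
  -- A symbol of `S` in `t^N X_0` lies in every lattice of this finite part, so the condition then
  -- fails throughout.
  by_cases hS : ∃ q ∈ S, (N : ℤ) ≤ q.2
  · obtain ⟨q, hqS, hq⟩ := hS
    convert @isOpen_empty _ (zariskiFinitePart n N d)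
    rw [Set.eq_empty_iff_forall_notMem]
    rintro ⟨Y, h1, h2, h3⟩ hY
    have hmem := Submodule.disjoint_def.1 hY (Finsupp.single q 1)
      (h1 (Finsupp.single_mem_supported ℂ 1 hq)) (Finsupp.single_mem_supported ℂ 1 hqS)
    simp at hmem
  · push Not at hS
    convert @isOpen_biUnion _ _ (zariskiFinitePart n N d)
      {q : Fin d → box n N | ∀ a, (q a : Fin n × ℤ) ∉ S}
      (fun q => basicOpen (MvPolynomial.X q)) fun q _ => isOpen_basicOpen_X q using 1
    ext Y
    simp only [Set.mem_ofPred_eq, Set.mem_iUnion, mem_basicOpen_X, exists_prop]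
    constructor
    · intro hY
      obtain ⟨v, hv⟩ := exists_isFrame Y
      -- Excluding the complement of the box as well forces the chosen columns into the box; nothing
      -- is lost, because frame vectors vanish outside it.
      obtain ⟨q, hq, hdet⟩ := exists_det_ne_zero_of_disjoint (s := S ∪ (box n N)ᶜ) hv.1 (by
        rw [hv.2, Submodule.disjoint_def]
        intro x hx hx2
        refine Submodule.disjoint_def.1 hY x hx.1 ?_
        have h1 := (Finsupp.mem_supported' ℂ x).1 hx.2
        rw [Finsupp.mem_supported'] at hx2 ⊢
        intro k hk
        by_cases hkb : k ∈ box n N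
        · exact hx2 k (by simp [hk, hkb])
        · exact h1 k hkb)
      refine ⟨fun a => ⟨q a, ?_⟩, fun a => ?_, v, hv, hdet⟩
      · by_contra h
        exact hq a (Or.inr h)
      · exact fun h => hq a (Or.inl h)
    · rintro ⟨q, hq, v, hv, hdet⟩
      rw [Submodule.disjoint_def]
      intro x hx hx2
      refine eq_zero_of_mem_span_of_det_ne_zero (v := v) (q := fun a => (q a : Fin n × ℤ)) hdet ?_
        fun a => (Finsupp.mem_supported' ℂ x).1 hx2 _ (hq a)
      rw [hv.2]
      refine ⟨hx, ?_⟩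
      have h2 := Y.2.2.1 hx
      rw [tX0] at h2
      rw [SetLike.mem_coe, Finsupp.mem_supported'] at *
      intro k hk
      by_cases hkS : k ∈ S
      · refine h2 k fun h => hk ⟨h, hS k hkS⟩
      · exact hx2 k hkS

/-! ### Families of lattices with a polynomial frame -/

/-- All maximal minors are multiplied by the determinant of the change of basis. -/
theorem exists_plucker_eq_smul {n N d : ℕ} {Y : LoopGrassmannian n} {v w : Fin d → X n}
    (hv : IsFrame N Y v) (hw : IsFrame N Y w) : ∃ c : ℂ, plucker N w = c • plucker N v := by
  have h : ∀ a, ∃ g : Fin d → ℂ, ∑ b, g b • v b = w a := fun a => by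
    rw [← Submodule.mem_span_range_iff_exists_fun, hv.2, ← hw.2]
    exact Submodule.subset_span ⟨a, rfl⟩
  choose g hg using h
  refine ⟨(Matrix.of g).det, ?_⟩
  funext q
  rw [Pi.smul_apply, smul_eq_mul, plucker, plucker, ← Matrix.det_mul]
  congr 1
  ext a b
  simp [← hg, Matrix.mul_apply, Finsupp.finsetSum_apply]

/-- If the lattices `F s` have frames that are polynomial in `s`, then every Zariski open set that
contains `F a` contains `F s` for all but finitely many `s`. -/
theorem eventually_mem_of_isFrame {n N d : ℕ} {F : ℂ → LoopGrassmannian n}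
    (v : ℂ → Fin d → X n) (P : Fin d → Fin n × ℤ → Polynomial ℂ)
    (hP : ∀ s a q, v s a q = (P a q).eval s) {a : ℂ} (ha : F a ∈ finitePart n N d)
    (hFa : IsFrame N (F a) (v a))
    (hF : ∀ᶠ s in cofinite, F s ∈ finitePart n N d ∧ IsFrame N (F s) (v s))
    {U : Set (LoopGrassmannian n)} (hU : IsOpen U) (hUa : F a ∈ U) :
    ∀ᶠ s in cofinite, F s ∈ U := by
  have key : ∀ V : Set (finitePart n N d),
      TopologicalSpace.GenerateOpen {U | ∃ (k : ℕ) (f : MvPolynomial (Fin d → box n N) ℂ),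
        f.IsHomogeneous k ∧ U = basicOpen f} V → ⟨F a, ha⟩ ∈ V →
      ∀ᶠ s in cofinite, ∃ h : F s ∈ finitePart n N d, ⟨F s, h⟩ ∈ V := by
    intro V hV
    induction hV with
    | basic V hV =>
      obtain ⟨k, f, hf, rfl⟩ := hV
      rintro ⟨w, hw, hne⟩
      -- The frame `w` need not be `v a`; homogeneity of `f` turns the scalar `c` into an overall
      -- factor `c ^ k`.
      obtain ⟨c, hc⟩ := exists_plucker_eq_smul hFa hw
      have hne' : MvPolynomial.eval (plucker N (v a)) f ≠ 0 := by
        intro h0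
        rw [hc, MvPolynomial.eval_eq] at hne
        rw [MvPolynomial.eval_eq] at h0
        apply hne
        have : ∀ m ∈ f.support, MvPolynomial.coeff m f * ∏ i ∈ m.support,
            (c • plucker N (v a)) i ^ m i = c ^ k * (MvPolynomial.coeff m f *
            ∏ i ∈ m.support, (plucker N (v a)) i ^ m i) := by
          intro m hm
          have hdeg := hf (MvPolynomial.mem_support_iff.1 hm)
          simp only [Pi.smul_apply, smul_eq_mul, mul_pow, Finset.prod_mul_distrib]
          rw [Finset.prod_pow_eq_pow_sum]
          have : ∑ i ∈ m.support, m i = k := by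
            rw [← hdeg, Finsupp.weight_apply]
            simp [Finsupp.sum]
          rw [this]
          ring
        rw [Finset.sum_congr rfl this, ← Finset.mul_sum, h0, mul_zero]
      let Q : (Fin d → box n N) → Polynomial ℂ :=
        fun q => (Matrix.of fun a b : Fin d => P a (q b : Fin n × ℤ)).det
      have hQ : ∀ s, plucker N (v s) = fun q => (Q q).eval s := by
        intro s
        funext q
        rw [plucker, ← Polynomial.coe_evalRingHom, RingHom.map_det]
        congr 1
        ext a b
        simp [hP]
      -- Along the family `f` becomes a one-variable polynomial in `s`, nonzero at `a`.
      have hR : ∀ s, MvPolynomial.eval (plucker N (v s)) f =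
          (MvPolynomial.aeval Q f).eval s := by
        intro s
        rw [hQ, MvPolynomial.aeval_def, MvPolynomial.eval₂_eq, MvPolynomial.eval_eq,
          Polynomial.eval_finsetSum]
        simp [Polynomial.eval_prod]
      rw [hR] at hne'
      filter_upwards [hF, eventually_eval_ne_zero hne'] with s hs1 hs2
      exact ⟨hs1.1, v s, hs1.2, by rwa [hR]⟩
    | univ =>
      intro _
      filter_upwards [hF] with s hs
      exact ⟨hs.1, trivial⟩
    | inter V W _ _ hV hW =>
      intro h
      filter_upwards [hV h.1, hW h.2] with s h1 h2
      exact ⟨h1.1, h1.2, h2.2⟩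
    | sUnion S _ hS =>
      rintro ⟨V, hVS, hV⟩
      filter_upwards [hS V hVS hV] with s hs
      exact ⟨hs.1, V, hVS, hs.2⟩
  filter_upwards [key _ (isOpen_iff_finitePart.1 hU N d) hUa] with s hs
  exact hs.2

end LoopGr

namespace LoopGr

noncomputable section

/-! ### Lattices with a given torus part -/

theorem tMul_apply {n : ℕ} (x : X n) (i : Fin n) (j : ℤ) : tMul n x (i, j) = x (i, j - 1) := by
  have hinj : Function.Injective fun q : Fin n × ℤ => (q.1, q.2 + 1) := by
    rintro ⟨a, b⟩ ⟨c, d⟩ h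
    simpa using h
  have := Finsupp.mapDomain_apply hinj x (i, j - 1)
  simpa [tMul] using this

theorem tMul_tE {n : ℕ} (i : Fin n) (j : ℤ) : tMul n (tE i j) = tE i (j + 1) := by
  simp [tMul, tE]

/-- The symbols `t^j e_i` with `i ∈ S` and `j ≥ -δ_i`. -/
def regular {n : ℕ} (δ : Fin n → ℤ) (S : Set (Fin n)) : Set (Fin n × ℤ) :=
  {q | q.1 ∈ S ∧ -δ q.1 ≤ q.2}

/-- The symbols `t^j e_i` with `i ∈ S` and `j < -δ_i`. -/
def polar {n : ℕ} (δ : Fin n → ℤ) (S : Set (Fin n)) : Set (Fin n × ℤ) :=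
  {q | q.1 ∈ S ∧ q.2 < -δ q.1}

/-- The torus part of `Y` is spanned by the `t^j e_i` with `j ≥ -δ_i`. -/
def HasTorus {n : ℕ} (Y : LoopGrassmannian n) (δ : Fin n → ℤ) : Prop :=
  ∀ i j, tE i j ∈ Y.space ↔ -δ i ≤ j

theorem tE_add_mem {n : ℕ} (Y : LoopGrassmannian n) {i : Fin n} {j : ℤ} (h : tE i j ∈ Y.space)
    (k : ℕ) : tE i (j + k) ∈ Y.space := by
  induction k with
  | zero => simpa using h
  | succ k ih =>
    have := Y.t_mem _ ih
    rw [tMul_tE] at this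
    push_cast
    rwa [← add_assoc]

theorem hasTorus_iff {n : ℕ} {Y : LoopGrassmannian n} {δ : Fin n → ℤ} :
    HasTorus Y δ ↔ ∀ i, IsDelta Y i (δ i) := by
  constructor
  · intro h i
    refine ⟨(h i _).2 le_rfl, fun j hj => ?_⟩
    have := (h i _).1 hj
    omega
  · intro h i j
    constructor
    · intro hj
      have := (h i).2 (show tE i (-(-j)) ∈ Y.space by rwa [neg_neg])
      omega
    · intro hj
      have := tE_add_mem Y (h i).1 (j + δ i).toNat
      rwa [show -δ i + ((j + δ i).toNat : ℤ) = j by omega] at this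

theorem torusPart_eq {n : ℕ} {Y : LoopGrassmannian n} {δ : Fin n → ℤ} (h : HasTorus Y δ)
    (S : Set (Fin n)) :
    torusPart (Y.space ⊓ cols S) = Finsupp.supported ℂ ℂ (regular δ S) := by
  rw [Finsupp.supported_eq_span_single, torusPart]
  congr 1
  ext x
  constructor
  · rintro ⟨⟨i, j, rfl⟩, h1, h2⟩
    refine ⟨(i, j), ⟨?_, (h i j).1 h1⟩, rfl⟩
    by_contra hi
    have := (Finsupp.mem_supported' ℂ _).1 h2 (i, j) hi
    simp [tE] at this
  · rintro ⟨⟨i, j⟩, ⟨h1, h2⟩, rfl⟩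
    exact ⟨⟨i, j, rfl⟩, (h i j).2 h2, Finsupp.single_mem_supported ℂ 1 h1⟩

theorem cols_univ {n : ℕ} : cols (Set.univ : Set (Fin n)) = ⊤ := by
  simp [cols]

theorem torusPart_space {n : ℕ} {Y : LoopGrassmannian n} {δ : Fin n → ℤ} (h : HasTorus Y δ) :
    torusPart Y.space = Finsupp.supported ℂ ℂ (regular δ Set.univ) := by
  rw [← torusPart_eq h, cols_univ, inf_top_eq]

theorem supported_regular_le {n : ℕ} {Y : LoopGrassmannian n} {δ : Fin n → ℤ} (h : HasTorus Y δ)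
    (S : Set (Fin n)) : Finsupp.supported ℂ ℂ (regular δ S) ≤ Y.space ⊓ cols S := by
  rw [← torusPart_eq h, torusPart, Submodule.span_le]
  exact fun x hx => hx.2

/-- The intersection of `Y ∩ V_S` with the span of the `t^j e_i`, `j < -δ_i`. -/
def polarPart {n : ℕ} (Y : LoopGrassmannian n) (δ : Fin n → ℤ) (S : Set (Fin n)) :
    Submodule ℂ (X n) :=
  Y.space ⊓ Finsupp.supported ℂ ℂ (polar δ S)

theorem polarPart_mono {n : ℕ} (Y : LoopGrassmannian n) (δ : Fin n → ℤ) {S S' : Set (Fin n)}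
    (h : S ⊆ S') : polarPart Y δ S ≤ polarPart Y δ S' :=
  inf_le_inf_left _ (Finsupp.supported_mono fun _ hq => ⟨h hq.1, hq.2⟩)

theorem polarPart_inf {n : ℕ} (Y : LoopGrassmannian n) (δ : Fin n → ℤ) (S S' : Set (Fin n)) :
    polarPart Y δ S ⊓ polarPart Y δ S' = polarPart Y δ (S ∩ S') := by
  rw [polarPart, polarPart, polarPart, ← inf_inf_distrib_left, ← Finsupp.supported_inter]
  congr 2
  ext q
  simp only [polar, Set.mem_inter_iff, Set.mem_ofPred_eq]
  tauto

instance finiteDimensional_polarPart {n : ℕ} (Y : LoopGrassmannian n) (δ : Fin n → ℤ)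
    (S : Set (Fin n)) : FiniteDimensional ℂ (polarPart Y δ S) := by
  obtain ⟨N, -, hN⟩ := Y.bounded
  have hfin : {q : Fin n × ℤ | -(N : ℤ) ≤ q.2 ∧ q.2 < -δ q.1}.Finite := by
    have : {q : Fin n × ℤ | -(N : ℤ) ≤ q.2 ∧ q.2 < -δ q.1} ⊆
        ⋃ i : Fin n, (fun j => (i, j)) '' Set.Ico (-(N : ℤ)) (-δ i) := by
      rintro ⟨i, j⟩ h
      exact Set.mem_iUnion.2 ⟨i, j, h, rfl⟩
    exact (Set.finite_iUnion fun i => (Set.finite_Ico _ _).image _).subset this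
  refine finiteDimensional_of_le_supported hfin ?_
  refine (inf_le_inf_right _ hN).trans ?_
  rw [tX0, ← Finsupp.supported_inter]
  exact Finsupp.supported_mono fun q hq => ⟨hq.1, hq.2.2⟩

-- The functions supported on `Aᶜ` form a complement to those supported on `A`, so they represent
-- the quotient. This replaces `dim0` by the dimension of an honest subspace.
open scoped Classical in
theorem finrank_map_mkQ_supported {α : Type*} (A : Set α) (Z : Submodule ℂ (α →₀ ℂ))
    (hA : Finsupp.supported ℂ ℂ A ≤ Z) :
    Module.finrank ℂ ↥(Z.map (Finsupp.supported ℂ ℂ A).mkQ) =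
      Module.finrank ℂ ↥(Z ⊓ Finsupp.supported ℂ ℂ Aᶜ) := by
  have hmap : Z.map (Finsupp.supported ℂ ℂ A).mkQ =
      (Z ⊓ Finsupp.supported ℂ ℂ Aᶜ).map (Finsupp.supported ℂ ℂ A).mkQ := by
    refine le_antisymm ?_ (Submodule.map_mono inf_le_left)
    rintro _ ⟨x, hx, rfl⟩
    have h1 : x.filter (· ∈ A) ∈ Finsupp.supported ℂ ℂ A :=
      (Finsupp.mem_supported' ℂ _).2 fun q hq => Finsupp.filter_apply_neg _ _ hq
    have h2 : x - x.filter (· ∈ A) ∈ Finsupp.supported ℂ ℂ Aᶜ :=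
      (Finsupp.mem_supported' ℂ _).2 fun q hq => by
        rw [Finsupp.sub_apply, Finsupp.filter_apply_pos _ _ (not_not.1 hq), sub_self]
    refine ⟨x - x.filter (· ∈ A), ⟨Z.sub_mem hx (hA h1), h2⟩, ?_⟩
    rw [map_sub, sub_eq_self]
    exact (Submodule.Quotient.mk_eq_zero _).2 h1
  rw [hmap, ← LinearMap.range_domRestrict]
  refine LinearMap.finrank_range_of_inj ?_
  rw [← LinearMap.ker_eq_bot, LinearMap.ker_eq_bot']
  rintro ⟨x, hx⟩ h
  have h1 : x ∈ Finsupp.supported ℂ ℂ A := (Submodule.Quotient.mk_eq_zero _).1 h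
  have := Submodule.disjoint_def.1
    (Finsupp.disjoint_supported_supported (M := ℂ) (R := ℂ) (disjoint_compl_right (a := A))) x h1 hx.2
  exact Subtype.ext this

theorem dim0_eq_finrank {n : ℕ} {Y : LoopGrassmannian n} {δ : Fin n → ℤ} (h : HasTorus Y δ)
    (S : Set (Fin n)) :
    dim0 (Y.space ⊓ cols S) = Module.finrank ℂ (polarPart Y δ S) := by
  have hset : {q : Fin n × ℤ | q.1 ∈ S} ∩ (regular δ S)ᶜ = polar δ S := by
    ext q
    constructor
    · rintro ⟨h1, h2⟩
      exact ⟨h1, not_le.1 fun h3 => h2 ⟨h1, h3⟩⟩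
    · rintro ⟨h1, h2⟩
      exact ⟨h1, fun h3 => absurd h3.2 (not_le.2 h2)⟩
  rw [dim0, torusPart_eq h, finrank_map_mkQ_supported _ _ (supported_regular_le h S), polarPart,
    inf_assoc, cols, ← Finsupp.supported_inter, hset]

/-! ### The truncated operator -/

open scoped Classical in
/-- The projection killing the `t^j e_i` with `j ≥ -δ_i`. -/
def trunc {n : ℕ} (δ : Fin n → ℤ) : X n →ₗ[ℂ] X n :=
  (Finsupp.supported ℂ ℂ (polar δ Set.univ)).subtype ∘ₗ
    Finsupp.restrictDom ℂ ℂ (polar δ Set.univ)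

theorem trunc_apply {n : ℕ} (δ : Fin n → ℤ) (x : X n) (q : Fin n × ℤ) :
    trunc δ x q = if q.2 < -δ q.1 then x q else 0 := by
  classical
  change (x.filter (· ∈ polar δ Set.univ)) q = _
  simp [Finsupp.filter_apply, polar]

theorem sub_trunc_mem {n : ℕ} (δ : Fin n → ℤ) (x : X n) :
    x - trunc δ x ∈ Finsupp.supported ℂ ℂ (regular δ Set.univ) := by
  rw [Finsupp.mem_supported']
  intro q hq
  have : q.2 < -δ q.1 := not_le.1 fun h => hq ⟨trivial, h⟩
  simp [trunc_apply, this]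

/-- The operator induced by `t` on the quotient of `X` by the span of the `t^j e_i`, `j ≥ -δ_i`. -/
def shift {n : ℕ} (δ : Fin n → ℤ) : X n →ₗ[ℂ] X n := trunc δ ∘ₗ tMul n

theorem shift_apply {n : ℕ} (δ : Fin n → ℤ) (x : X n) (i : Fin n) (j : ℤ) :
    shift δ x (i, j) = if j < -δ i then x (i, j - 1) else 0 := by
  simp [shift, trunc_apply, tMul_apply]

/-- The terms of `t x` that `trunc` removes belong to the torus part, hence to `Y`. -/
theorem shift_mem_polarPart {n : ℕ} {Y : LoopGrassmannian n} {δ : Fin n → ℤ} (h : HasTorus Y δ)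
    {S : Set (Fin n)} {x : X n} (hx : x ∈ polarPart Y δ S) : shift δ x ∈ polarPart Y δ S := by
  refine ⟨?_, ?_⟩
  · have h1 := Y.t_mem x hx.1
    have h2 := (supported_regular_le h _ (sub_trunc_mem δ (tMul n x))).1
    have := Y.space.sub_mem h1 h2
    rwa [sub_sub_cancel] at this
  · rw [SetLike.mem_coe, Finsupp.mem_supported']
    rintro ⟨i, j⟩ hq
    rw [shift_apply]
    split_ifs with hj
    · exact (Finsupp.mem_supported' ℂ x).1 hx.2 _ fun h' => hq ⟨h'.1, hj⟩
    · rfl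

theorem shift_pow_apply {n : ℕ} (δ : Fin n → ℤ) (x : X n) (i : Fin n) {j : ℤ} (hj : j < -δ i)
    (k : ℕ) : ((shift δ) ^ k) x (i, j) = x (i, j - k) := by
  induction k generalizing j with
  | zero => simp
  | succ k ih =>
    rw [pow_succ', Module.End.mul_apply, shift_apply, if_pos hj, ih (by omega)]
    congr 2
    push_cast
    ring

theorem exists_shift_pow_eq_zero {n : ℕ} (δ : Fin n → ℤ) (x : X n) :
    ∃ k, ((shift δ) ^ k) x = 0 := by
  obtain ⟨K, hK⟩ : ∃ K : ℕ, ∀ q ∈ x.support, (-δ q.1 - q.2).toNat ≤ K :=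
    ⟨x.support.sup fun q => (-δ q.1 - q.2).toNat, fun q hq =>
      Finset.le_sup (f := fun q : Fin n × ℤ => (-δ q.1 - q.2).toNat) hq⟩
  refine ⟨K + 1, ?_⟩
  ext ⟨i, j⟩
  by_cases hj : j < -δ i
  · rw [shift_pow_apply δ x i hj]
    by_contra hne
    have := hK _ (Finsupp.mem_support_iff.2 hne)
    push_cast at this
    omega
  · rw [pow_succ', Module.End.mul_apply, shift_apply, if_neg hj]
    rfl

/-- The last nonzero iterate of `shift` on a vector in a single column is a multiple of the symbol
just below the torus part, which `Y` does not contain. This is the base case of the inductions over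
intervals. -/
theorem polarPart_eq_bot {n : ℕ} {Y : LoopGrassmannian n} {δ : Fin n → ℤ} (h : HasTorus Y δ)
    {S : Set (Fin n)} (hS : S.Subsingleton) : polarPart Y δ S = ⊥ := by
  classical
  rw [Submodule.eq_bot_iff]
  intro x hx
  by_contra hne
  obtain ⟨k, hk, hk2⟩ : ∃ k, ((shift δ) ^ k) x ≠ 0 ∧ ((shift δ) ^ (k + 1)) x = 0 := by
    have hex := exists_shift_pow_eq_zero δ x
    have h0 : Nat.find hex ≠ 0 := fun h0 => hne (by simpa [h0] using Nat.find_spec hex)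
    refine ⟨Nat.find hex - 1, Nat.find_min hex (by omega), ?_⟩
    rw [Nat.sub_add_cancel (by omega)]
    exact Nat.find_spec hex
  have hz : ((shift δ) ^ k) x ∈ polarPart Y δ S := by
    clear hk hk2
    induction k with
    | zero => simpa using hx
    | succ k ih =>
      rw [pow_succ', Module.End.mul_apply]
      exact shift_mem_polarPart h ih
  rw [pow_succ', Module.End.mul_apply] at hk2
  generalize ((shift δ) ^ k) x = z at *
  obtain ⟨⟨i, j⟩, hij⟩ := Finsupp.ne_iff.1 hk
  have hvan := (Finsupp.mem_supported' ℂ z).1 hz.2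
  have hpol : (i, j) ∈ polar δ S := by
    by_contra hq
    exact hij (hvan _ hq)
  have hzj : ∀ q : Fin n × ℤ, z q ≠ 0 → q = (i, -δ i - 1) := by
    rintro ⟨a, b⟩ hab
    have hq : (a, b) ∈ polar δ S := by
      by_contra hq
      exact hab (hvan _ hq)
    have hai : a = i := hS hq.1 hpol.1
    subst hai
    have h3 := DFunLike.congr_fun hk2 (a, b + 1)
    rw [shift_apply, add_sub_cancel_right] at h3
    have hb : ¬ b + 1 < -δ a := fun hlt => by
      rw [if_pos hlt] at h3
      exact hab h3
    have hq2 : b < -δ a := hq.2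
    rw [Prod.mk.injEq]
    exact ⟨rfl, by omega⟩
  have hzz : (z (i, j))⁻¹ • z = tE i (-δ i - 1) := by
    ext q
    rw [Finsupp.smul_apply, smul_eq_mul]
    by_cases hq : z q = 0
    · rw [hq, mul_zero, tE, Finsupp.single_apply, if_neg]
      rintro rfl
      rw [← hzj _ hij] at hq
      exact hij hq
    · rw [hzj _ hq, hzj _ hij, inv_mul_cancel₀]
      · simp [tE]
      · rw [← hzj _ hq]
        exact hq
  have hmem : tE i (-δ i - 1) ∈ Y.space := hzz ▸ Y.space.smul_mem _ hz.1
  have := (h i _).1 hmem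
  omega

end

end LoopGr

namespace LoopGr

noncomputable section

/-! ### Counting loops -/

open scoped Classical in
instance {n : ℕ} : Fintype (PosRoot n) :=
  inferInstanceAs (Fintype {q : Fin n × Fin n // q.1 < q.2})

instance {n : ℕ} (p : KostantPicture n) : Fintype (Loop p) :=
  @Sigma.instFintype (PosRoot n) (fun α => Fin (p α)) (fun α => Fin.fintype (p α)) _

/-- The interval of columns `i` with `a ≤ i < b`. -/
def interval (n a b : ℕ) : Set (Fin n) := {i | a ≤ (i : ℕ) ∧ (i : ℕ) < b}

open scoped Classical in
/-- The loops of `p` that pass only through columns `i` with `a ≤ i < b`. -/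
def loopsIn {n : ℕ} (p : KostantPicture n) (a b : ℕ) : Finset (Loop p) :=
  Finset.univ.filter fun L => a ≤ (L.left : ℕ) ∧ (L.right : ℕ) < b

theorem mem_loopsIn {n : ℕ} {p : KostantPicture n} {a b : ℕ} {L : Loop p} :
    L ∈ loopsIn p a b ↔ a ≤ (L.left : ℕ) ∧ (L.right : ℕ) < b := by
  simp [loopsIn]

theorem Loop.left_lt_right {n : ℕ} {p : KostantPicture n} (L : Loop p) :
    (L.left : ℕ) < (L.right : ℕ) := L.1.2

theorem loopsIn_eq_empty {n : ℕ} (p : KostantPicture n) {a b : ℕ} (h : b ≤ a + 1) :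
    loopsIn p a b = ∅ := by
  rw [Finset.eq_empty_iff_forall_notMem]
  intro L hL
  have := mem_loopsIn.1 hL
  have := L.left_lt_right
  omega

theorem interval_subsingleton {n a b : ℕ} (h : b ≤ a + 1) : (interval n a b).Subsingleton := by
  rintro i ⟨h1, h2⟩ j ⟨h3, h4⟩
  exact Fin.ext (by omega)

/-- Inclusion–exclusion: a loop inside the interval either has both ends of `α` or avoids one of the
two end columns. -/
theorem card_loopsIn {n : ℕ} (p : KostantPicture n) (α : PosRoot n) :
    (loopsIn p α.1.1 (α.1.2 + 1)).card + (loopsIn p (α.1.1 + 1) α.1.2).card =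
      p α + (loopsIn p (α.1.1 + 1) (α.1.2 + 1)).card + (loopsIn p α.1.1 α.1.2).card := by
  classical
  have hα : (α.1.1 : ℕ) < α.1.2 := α.2
  have hfib : (Finset.univ.filter fun L : Loop p => L.1 = α).card = p α := by
    rw [← Fintype.card_subtype, ← Nat.card_eq_fintype_card]
    exact (Nat.card_congr
      (Equiv.sigmaSubtype (β := fun α : PosRoot n => Fin (p α)) α)).trans (Nat.card_fin _)
  have hunion : loopsIn p α.1.1 (α.1.2 + 1) =
      (Finset.univ.filter fun L : Loop p => L.1 = α) ∪
        (loopsIn p (α.1.1 + 1) (α.1.2 + 1) ∪ loopsIn p α.1.1 α.1.2) := by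
    ext L
    simp only [Finset.mem_union, Finset.mem_filter, Finset.mem_univ, true_and, mem_loopsIn]
    have : L.1 = α ↔ (L.left : ℕ) = α.1.1 ∧ (L.right : ℕ) = α.1.2 := by
      constructor
      · rintro rfl
        exact ⟨rfl, rfl⟩
      · rintro ⟨h1, h2⟩
        exact Subtype.ext (Prod.ext (Fin.ext h1) (Fin.ext h2))
    rw [this]
    omega
  have hinter : loopsIn p (α.1.1 + 1) (α.1.2 + 1) ∩ loopsIn p α.1.1 α.1.2 =
      loopsIn p (α.1.1 + 1) α.1.2 := by
    ext L
    simp only [Finset.mem_inter, mem_loopsIn]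
    omega
  have hdisj : Disjoint (Finset.univ.filter fun L : Loop p => L.1 = α)
      (loopsIn p (α.1.1 + 1) (α.1.2 + 1) ∪ loopsIn p α.1.1 α.1.2) := by
    rw [Finset.disjoint_left]
    intro L h1 h2
    simp only [Finset.mem_union, Finset.mem_filter, Finset.mem_univ, true_and, mem_loopsIn] at h1 h2
    subst h1
    change (L.left : ℕ) + 1 ≤ L.left ∧ _ ∨ _ ∧ (L.right : ℕ) < L.right at h2
    omega
  have := Finset.card_union_add_card_inter (loopsIn p (α.1.1 + 1) (α.1.2 + 1))
    (loopsIn p α.1.1 α.1.2)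
  rw [hunion, Finset.card_union_of_disjoint hdisj, hfib]
  rw [hinter] at this
  omega

theorem Icc_eq_interval {n : ℕ} (l r : Fin n) : Set.Icc l r = interval n l (r + 1) := by
  ext i
  simp only [Set.mem_Icc, interval, Set.mem_ofPred_eq, Fin.le_def]
  omega

theorem Ioc_eq_interval {n : ℕ} (l r : Fin n) : Set.Ioc l r = interval n (l + 1) (r + 1) := by
  ext i
  simp only [Set.mem_Ioc, interval, Set.mem_ofPred_eq, Fin.le_def, Fin.lt_def]
  omega

theorem Ico_eq_interval {n : ℕ} (l r : Fin n) : Set.Ico l r = interval n l r := by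
  ext i
  simp only [Set.mem_Ico, interval, Set.mem_ofPred_eq, Fin.le_def, Fin.lt_def]

theorem Ioo_eq_interval {n : ℕ} (l r : Fin n) : Set.Ioo l r = interval n (l + 1) r := by
  ext i
  simp only [Set.mem_Ioo, interval, Set.mem_ofPred_eq, Fin.lt_def]
  omega

theorem loopCount_eq {n : ℕ} {Y : LoopGrassmannian n} {δ : Fin n → ℤ} (h : HasTorus Y δ)
    (α : PosRoot n) :
    loopCount Y α = Module.finrank ℂ (polarPart Y δ (interval n α.1.1 (α.1.2 + 1)))
      - Module.finrank ℂ (polarPart Y δ (interval n (α.1.1 + 1) (α.1.2 + 1)))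
      - Module.finrank ℂ (polarPart Y δ (interval n α.1.1 α.1.2))
      + Module.finrank ℂ (polarPart Y δ (interval n (α.1.1 + 1) α.1.2)) := by
  rw [loopCount, dim0_eq_finrank h, dim0_eq_finrank h, dim0_eq_finrank h, dim0_eq_finrank h,
    Icc_eq_interval, Ioc_eq_interval, Ico_eq_interval, Ioo_eq_interval]

theorem exists_posRoot {n a b : ℕ} (hab : a + 1 < b) (hb : b ≤ n) :
    ∃ α : PosRoot n, (α.1.1 : ℕ) = a ∧ (α.1.2 : ℕ) = b - 1 :=
  ⟨⟨(⟨a, by omega⟩, ⟨b - 1, by omega⟩), Fin.mk_lt_mk.2 (by omega)⟩, rfl, rfl⟩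

/-- A lattice has Kostant picture `p` if and only if `dim_0` of its intersection with every interval
of columns is the number of loops of `p` inside the interval. -/
theorem loopCount_eq_iff {n : ℕ} {Y : LoopGrassmannian n} {δ : Fin n → ℤ} (h : HasTorus Y δ)
    (p : KostantPicture n) :
    (∀ α, loopCount Y α = p α) ↔ ∀ a b, b ≤ n →
      Module.finrank ℂ (polarPart Y δ (interval n a b)) = (loopsIn p a b).card := by
  constructor
  · intro hp a b hb
    -- Dimensions and loop counts satisfy the same four-term relation and both vanish on intervals
    -- of at most one column, so they agree by induction on length.
    induction hm : b - a using Nat.strong_induction_on generalizing a b with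
    | _ m ih =>
    by_cases hab : b ≤ a + 1
    · rw [polarPart_eq_bot h (interval_subsingleton hab), loopsIn_eq_empty p hab, finrank_bot,
        Finset.card_empty]
    · obtain ⟨α, rfl, hα⟩ := exists_posRoot (show a + 1 < b by omega) hb
      have h1 := hp α
      have h2 := card_loopsIn p α
      have := α.1.1.isLt
      rw [loopCount_eq h] at h1
      generalize (α.1.1 : ℕ) = a at *
      rw [hα, Nat.sub_add_cancel (by omega)] at h1 h2
      rw [ih _ (by omega) (a + 1) b hb rfl, ih _ (by omega) a (b - 1) (by omega) rfl,
        ih _ (by omega) (a + 1) (b - 1) (by omega) rfl] at h1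
      omega
  · intro hp α
    have h2 := card_loopsIn p α
    have := α.1.2.isLt
    rw [loopCount_eq h, hp _ _ (by omega), hp _ _ (by omega), hp _ _ (by omega), hp _ _ (by omega)]
    omega

/-- The pair `p`, `lam` determines `δ`, so all lattices of one piece share their torus part. -/
theorem mem_piece_iff {n : ℕ} {p : KostantPicture n} {lam : Fin n → ℤ} {Y : LoopGrassmannian n} :
    Y ∈ piece p lam ↔ HasTorus Y (fun i => lam i - numLeft p i) ∧ ∀ α, loopCount Y α = p α := by
  constructor
  · rintro ⟨h1, δ, h2, h3⟩
    refine ⟨hasTorus_iff.2 fun i => ?_, h1⟩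
    rw [h3 i, add_sub_cancel_right]
    exact h2 i
  · rintro ⟨h1, h2⟩
    exact ⟨h2, _, hasTorus_iff.1 h1, fun i => (sub_add_cancel _ _).symm⟩

/-! ### Existence of flags -/

/-- A basis of the polar part of `Y` that generates a `p`-flag. -/
structure IsPolarFlagBasis {n : ℕ} {p : KostantPicture n} (Y : LoopGrassmannian n)
    (δ : Fin n → ℤ) (y : Loop p → X n) : Prop where
  linearIndependent : LinearIndependent ℂ y
  span_eq : Submodule.span ℂ (Set.range y) = polarPart Y δ Set.univ
  mem_V : ∀ L, y L ∈ L.V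
  shift_mem : ∀ L, shift δ (y L) ∈ Submodule.span ℂ (y '' {L' | L'.Encircled L})

/-- Cutting vectors with `trunc` splits `Y` into torus part and polar part, and `shift` agrees with
`t` modulo the torus part. -/
theorem IsPolarFlagBasis.isFlagBasis {n : ℕ} {p : KostantPicture n} {Y : LoopGrassmannian n}
    {δ : Fin n → ℤ} {y : Loop p → X n} (hy : IsPolarFlagBasis Y δ y) (h : HasTorus Y δ) :
    IsFlagBasis Y y where
  linearIndependent := hy.linearIndependent
  disjoint := by
    rw [torusPart_space h, hy.span_eq]
    refine (Finsupp.disjoint_supported_supported ?_).mono_right inf_le_right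
    rw [Set.disjoint_left]
    exact fun q h1 h2 => absurd h1.2 (not_le.2 h2.2)
  sup_eq := by
    rw [torusPart_space h, hy.span_eq]
    have hT := (supported_regular_le h Set.univ).trans inf_le_left
    refine le_antisymm (sup_le hT inf_le_left) fun x hx => ?_
    have h1 := sub_trunc_mem δ x
    rw [← sub_add_cancel x (trunc δ x)]
    refine Submodule.add_mem_sup h1 ⟨?_, ?_⟩
    · have := Y.space.sub_mem hx (hT h1)
      rwa [sub_sub_cancel] at this
    · exact (Finsupp.mem_supported' ℂ _).2 fun q hq => by
        rw [trunc_apply, if_neg fun hlt => hq ⟨trivial, hlt⟩]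
  mem_V := hy.mem_V
  t_mem L := by
    rw [torusPart_space h, ← sub_add_cancel (tMul n (y L)) (trunc δ (tMul n (y L)))]
    exact Submodule.add_mem_sup (sub_trunc_mem _ _) (hy.shift_mem L)

/-- A locally nilpotent operator on `N / N'` has an invariant full flag. -/
theorem exists_lift_flag {V : Type*} [AddCommGroup V] [Module ℂ V] (f : Module.End ℂ V)
    (N : Submodule ℂ V) [FiniteDimensional ℂ N] (hfN : ∀ x ∈ N, f x ∈ N)
    (hnil : ∀ x, ∃ k, (f ^ k) x = 0) (m : ℕ) (N' : Submodule ℂ V) (hle : N' ≤ N)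
    (hf : ∀ x ∈ N', f x ∈ N') (hdim : Module.finrank ℂ N = Module.finrank ℂ N' + m) :
    ∃ y : Fin m → V, (∀ k, y k ∈ N) ∧
      (∀ k, f (y k) ∈ N' ⊔ Submodule.span ℂ (y '' {j | j < k})) ∧
      N ≤ N' ⊔ Submodule.span ℂ (Set.range y) := by
  classical
  induction m generalizing N' with
  | zero =>
    refine ⟨Fin.elim0, fun k => k.elim0, fun k => k.elim0, ?_⟩
    have := Submodule.eq_of_le_of_finrank_eq hle (by omega)
    rw [this]
    exact le_sup_left
  | succ m ih =>
    have hlt : N' < N := lt_of_le_of_ne hle fun heq => by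
      rw [heq] at hdim
      omega
    obtain ⟨z, hzN, hzN'⟩ := SetLike.exists_of_lt hlt
    have hex : ∃ k, (f ^ k) z ∈ N' := (hnil z).imp fun k hk => by rw [hk]; exact N'.zero_mem
    have h0 : Nat.find hex ≠ 0 := fun h0 => hzN' (by simpa [h0] using Nat.find_spec hex)
    have hmem : ∀ k, (f ^ k) z ∈ N := fun k => by
      induction k with
      | zero => simpa using hzN
      | succ k ih =>
        rw [pow_succ', Module.End.mul_apply]
        exact hfN _ ih
    obtain ⟨x, hxN, hxN', hfx⟩ : ∃ x ∈ N, x ∉ N' ∧ f x ∈ N' := by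
      -- The last iterate of `z` outside `N'` can be adjoined as the first vector of the flag.
      refine ⟨(f ^ (Nat.find hex - 1)) z, hmem _, Nat.find_min hex (by omega), ?_⟩
      rw [← Module.End.mul_apply, ← pow_succ', Nat.sub_add_cancel (by omega)]
      exact Nat.find_spec hex
    have hle' : N' ⊔ Submodule.span ℂ {x} ≤ N :=
      sup_le hle ((Submodule.span_singleton_le_iff_mem _ _).2 hxN)
    have : FiniteDimensional ℂ N' := Submodule.finiteDimensional_of_le hle
    obtain ⟨y, hy1, hy2, hy3⟩ := ih (N' ⊔ Submodule.span ℂ {x}) hle' (fun w hw => by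
      obtain ⟨u, hu, v, hv, rfl⟩ := Submodule.mem_sup.1 hw
      obtain ⟨c, rfl⟩ := Submodule.mem_span_singleton.1 hv
      rw [map_add, map_smul]
      exact Submodule.mem_sup_left (N'.add_mem (hf u hu) (N'.smul_mem c hfx))) (by
      have h1 := Submodule.finrank_sup_add_finrank_inf_eq N' (Submodule.span ℂ {x})
      have hx0 : x ≠ 0 := fun h => hxN' (h ▸ N'.zero_mem)
      rw [finrank_span_singleton hx0, ((Submodule.disjoint_span_singleton' hx0).2 hxN').eq_bot,
        finrank_bot] at h1
      omega)
    refine ⟨Fin.cons x y, fun k => ?_, fun k => ?_, ?_⟩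
    · refine Fin.cases ?_ (fun k => ?_) k
      · simpa using hxN
      · simpa using hy1 k
    · refine Fin.cases ?_ (fun k => ?_) k
      · exact Submodule.mem_sup_left (by simpa using hfx)
      · rw [Fin.cons_succ]
        refine (?_ : _ ≤ N' ⊔ _) (hy2 k)
        rw [sup_assoc]
        refine sup_le_sup_left (sup_le ?_ ?_) _
        · rw [Submodule.span_singleton_le_iff_mem]
          exact Submodule.subset_span ⟨0, Fin.succ_pos k, by simp⟩
        · refine Submodule.span_mono ?_
          rintro _ ⟨j, hj, rfl⟩
          exact ⟨j.succ, Fin.succ_lt_succ_iff.2 hj, by simp⟩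
    · refine hy3.trans ?_
      rw [sup_assoc, Fin.range_cons, ← Submodule.span_union, Set.singleton_union]

theorem polarPart_le_cols {n : ℕ} (Y : LoopGrassmannian n) (δ : Fin n → ℤ) (S : Set (Fin n)) :
    polarPart Y δ S ≤ cols S :=
  inf_le_right.trans (Finsupp.supported_mono fun _ hq => hq.1)

theorem interval_mono {n a b a' b' : ℕ} (h1 : a' ≤ a) (h2 : b ≤ b') :
    interval n a b ⊆ interval n a' b' := fun _ hi => ⟨h1.trans hi.1, hi.2.trans_le h2⟩

theorem interval_eq_univ (n : ℕ) : interval n 0 n = Set.univ :=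
  Set.eq_univ_of_forall fun i => ⟨Nat.zero_le _, i.isLt⟩

theorem polarPart_interval_inf {n : ℕ} (Y : LoopGrassmannian n) (δ : Fin n → ℤ) (a b : ℕ) :
    polarPart Y δ (interval n (a + 1) (b + 1)) ⊓ polarPart Y δ (interval n a b) =
      polarPart Y δ (interval n (a + 1) b) := by
  rw [polarPart_inf]
  congr 1
  ext i
  simp only [interval, Set.mem_inter_iff, Set.mem_ofPred_eq]
  omega

/-- Every lattice with Kostant picture `p` has a `p`-flag. -/
theorem exists_isPolarFlagBasis {n : ℕ} {p : KostantPicture n} {Y : LoopGrassmannian n}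
    {δ : Fin n → ℤ} (h : HasTorus Y δ) (hp : ∀ α, loopCount Y α = p α) :
    ∃ y : Loop p → X n, IsPolarFlagBasis Y δ y := by
  -- Root by root: the polar part of the interval modulo the sum of those of its two shorter
  -- intervals has dimension `p α`, and a `shift`-invariant full flag of this quotient supplies the
  -- vectors for the nested loops around `α`.
  have hroot : ∀ α : PosRoot n, ∃ y : Fin (p α) → X n,
      (∀ k, y k ∈ polarPart Y δ (interval n α.1.1 (α.1.2 + 1))) ∧
      (∀ k, shift δ (y k) ∈ (polarPart Y δ (interval n (α.1.1 + 1) (α.1.2 + 1)) ⊔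
        polarPart Y δ (interval n α.1.1 α.1.2)) ⊔ Submodule.span ℂ (y '' {j | j < k})) ∧
      polarPart Y δ (interval n α.1.1 (α.1.2 + 1)) ≤
        (polarPart Y δ (interval n (α.1.1 + 1) (α.1.2 + 1)) ⊔
          polarPart Y δ (interval n α.1.1 α.1.2)) ⊔ Submodule.span ℂ (Set.range y) := by
    intro α
    refine exists_lift_flag (shift δ) _ (fun x hx => shift_mem_polarPart h hx)
      (exists_shift_pow_eq_zero δ) (p α) _ ?_ ?_ ?_
    · exact sup_le (polarPart_mono Y δ (interval_mono (Nat.le_succ _) le_rfl))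
        (polarPart_mono Y δ (interval_mono le_rfl (Nat.le_succ _)))
    · intro x hx
      obtain ⟨u, hu, v, hv, rfl⟩ := Submodule.mem_sup.1 hx
      rw [map_add]
      exact Submodule.add_mem_sup (shift_mem_polarPart h hu) (shift_mem_polarPart h hv)
    · have h1 := Submodule.finrank_sup_add_finrank_inf_eq
        (polarPart Y δ (interval n (α.1.1 + 1) (α.1.2 + 1))) (polarPart Y δ (interval n α.1.1 α.1.2))
      have h2 := hp α
      rw [polarPart_interval_inf] at h1
      rw [loopCount_eq h] at h2
      omega
  choose y hyN hyf hyspan using hroot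
  have hspan : ∀ a b, b ≤ n → polarPart Y δ (interval n a b) ≤
      Submodule.span ℂ ((fun L : Loop p => y L.1 L.2) '' (loopsIn p a b : Set (Loop p))) := by
    intro a b hb
    induction hm : b - a using Nat.strong_induction_on generalizing a b with
    | _ m ih =>
    by_cases hab : b ≤ a + 1
    · rw [polarPart_eq_bot h (interval_subsingleton hab)]
      exact bot_le
    · obtain ⟨α, hα', hα⟩ := exists_posRoot (show a + 1 < b by omega) hb
      have h1 := hyspan α
      rw [hα, hα', Nat.sub_add_cancel (by omega)] at h1
      refine h1.trans (sup_le (sup_le ?_ ?_) ?_)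
      · refine (ih _ (by omega) (a + 1) b hb rfl).trans (Submodule.span_mono (Set.image_mono ?_))
        intro L hL
        rw [Finset.mem_coe, mem_loopsIn] at *
        omega
      · refine (ih _ (by omega) a (b - 1) (by omega) rfl).trans
          (Submodule.span_mono (Set.image_mono ?_))
        intro L hL
        rw [Finset.mem_coe, mem_loopsIn] at *
        omega
      · refine Submodule.span_mono ?_
        rintro _ ⟨k, rfl⟩
        refine ⟨⟨α, k⟩, Finset.mem_coe.2 (mem_loopsIn.2 ?_), rfl⟩
        change a ≤ (α.1.1 : ℕ) ∧ (α.1.2 : ℕ) < b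
        omega
  have hall : (loopsIn p 0 n : Set (Loop p)) = Set.univ := by
    refine Set.eq_univ_of_forall fun L => ?_
    rw [Finset.mem_coe, mem_loopsIn]
    exact ⟨Nat.zero_le _, L.right.isLt⟩
  have htop : Submodule.span ℂ (Set.range fun L : Loop p => y L.1 L.2) =
      polarPart Y δ Set.univ := by
    refine le_antisymm ?_ ?_
    · rw [Submodule.span_le]
      rintro _ ⟨L, rfl⟩
      exact polarPart_mono Y δ (Set.subset_univ _) (hyN L.1 L.2)
    · have := hspan 0 n le_rfl
      rwa [hall, Set.image_univ, interval_eq_univ] at this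
  refine ⟨fun L => y L.1 L.2, ?_, htop, fun L => ?_, fun L => ?_⟩
  -- Independence is obtained by counting: the spanning family has as many members as the dimension
  -- of the polar part.
  · rw [linearIndependent_iff_card_eq_finrank_span, Set.finrank, htop, ← interval_eq_univ,
      (loopCount_eq_iff h p).1 hp 0 n le_rfl, Fintype.card, ← Finset.coe_inj.1 (hall.trans Finset.coe_univ.symm)]
  · rw [Loop.V, Icc_eq_interval]
    exact polarPart_le_cols Y δ _ (hyN L.1 L.2)
  -- The two shorter intervals contribute loops around smaller roots, the third summand the inner
  -- loops around the same root; all are encircled by `L`.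
  · refine (sup_le (sup_le ?_ ?_) ?_ : _ ≤ Submodule.span ℂ _) (hyf L.1 L.2)
    · refine (hspan _ _ L.1.1.2.isLt).trans (Submodule.span_mono (Set.image_mono ?_))
      intro L' hL'
      have h1 := mem_loopsIn.1 hL'
      refine Or.inl ⟨fun he => ?_, ?_, ?_⟩
      · have : L'.left = L.1.1.1 := congrArg (fun α : PosRoot n => α.1.1) he
        rw [this] at h1
        omega
      · exact Fin.le_def.2 (by have := h1.1; change (L.1.1.1 : ℕ) ≤ _; omega)
      · exact Fin.le_def.2 (by have := h1.2; change _ ≤ (L.1.1.2 : ℕ); omega)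
    · refine (hspan _ _ L.1.1.2.isLt.le).trans (Submodule.span_mono (Set.image_mono ?_))
      intro L' hL'
      have h1 := mem_loopsIn.1 hL'
      refine Or.inl ⟨fun he => ?_, ?_, ?_⟩
      · have : L'.right = L.1.1.2 := congrArg (fun α : PosRoot n => α.1.2) he
        rw [this] at h1
        omega
      · exact Fin.le_def.2 (by have := h1.1; change (L.1.1.1 : ℕ) ≤ _; omega)
      · exact Fin.le_def.2 (by have := h1.2; change _ ≤ (L.1.1.2 : ℕ); omega)
    · refine Submodule.span_mono ?_
      rintro _ ⟨k, hk, rfl⟩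
      exact ⟨⟨L.1, k⟩, Or.inr ⟨rfl, hk⟩, rfl⟩

/-! ### Polar parts of intervals in terms of a flag basis -/

theorem Loop.V_le_cols {n : ℕ} {p : KostantPicture n} {L : Loop p} {a b : ℕ}
    (hL : L ∈ loopsIn p a b) : L.V ≤ cols (interval n a b) := by
  refine Finsupp.supported_mono fun q hq => ?_
  have h1 := mem_loopsIn.1 hL
  exact ⟨h1.1.trans (Fin.le_def.1 hq.1), (Fin.le_def.1 hq.2).trans_lt h1.2⟩

theorem inf_supported_polar {n : ℕ} (Y : LoopGrassmannian n) (δ : Fin n → ℤ) (S : Set (Fin n)) :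
    polarPart Y δ Set.univ ⊓ cols S = polarPart Y δ S := by
  rw [polarPart, polarPart, inf_assoc, cols, ← Finsupp.supported_inter]
  congr 2
  ext q
  simp only [polar, Set.mem_inter_iff, Set.mem_ofPred_eq, Set.mem_univ, true_and]
  tauto

theorem finrank_span_image {n : ℕ} {p : KostantPicture n} {y : Loop p → X n}
    (hy : LinearIndependent ℂ y) (s : Finset (Loop p)) :
    Module.finrank ℂ (Submodule.span ℂ (y '' (s : Set (Loop p)))) = s.card := by
  have h := finrank_span_eq_card (hy.comp (Subtype.val : s → Loop p) Subtype.val_injective)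
  rwa [Set.range_comp, Subtype.range_coe_subtype, Fintype.card_coe] at h

/-- The vectors of the loops inside the interval lie in this polar part because `y_L ∈ V_L`, and the
Kostant picture makes the dimensions equal. -/
theorem IsPolarFlagBasis.polarPart_interval {n : ℕ} {p : KostantPicture n}
    {Y : LoopGrassmannian n} {δ : Fin n → ℤ} {y : Loop p → X n} (hy : IsPolarFlagBasis Y δ y)
    (h : HasTorus Y δ) (hp : ∀ α, loopCount Y α = p α) {a b : ℕ} (hb : b ≤ n) :
    polarPart Y δ (interval n a b) = Submodule.span ℂ (y '' (loopsIn p a b : Set (Loop p))) := by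
  refine (Submodule.eq_of_le_of_finrank_eq ?_ ?_).symm
  · rw [Submodule.span_le]
    rintro _ ⟨L, hL, rfl⟩
    have h1 : y L ∈ polarPart Y δ Set.univ := hy.span_eq ▸ Submodule.subset_span ⟨L, rfl⟩
    rw [← inf_supported_polar]
    exact ⟨h1, Loop.V_le_cols hL (hy.mem_V L)⟩
  · rw [(loopCount_eq_iff h p).1 hp a b hb, finrank_span_image hy.linearIndependent]

end

end LoopGr

namespace LoopGr

noncomputable section

/-! ### Heights of loops -/

/-- The loop passes through the column `i`. -/
def Loop.Passes {n : ℕ} {p : KostantPicture n} (L : Loop p) (i : Fin n) : Prop :=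
  L.left ≤ i ∧ i ≤ L.right

theorem Loop.Encircled.left_le {n : ℕ} {p : KostantPicture n} {L L' : Loop p}
    (h : L.Encircled L') : L'.left ≤ L.left := by
  rcases h with h | h
  · exact h.2.1
  · rw [Loop.left, Loop.left, h.1]

theorem Loop.Encircled.right_le {n : ℕ} {p : KostantPicture n} {L L' : Loop p}
    (h : L.Encircled L') : L.right ≤ L'.right := by
  rcases h with h | h
  · exact h.2.2
  · rw [Loop.right, Loop.right, h.1]

theorem Loop.root_eq {n : ℕ} {p : KostantPicture n} {L L' : Loop p} (h1 : L.left = L'.left)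
    (h2 : L.right = L'.right) : L.1 = L'.1 :=
  Subtype.ext (Prod.ext h1 h2)

theorem Loop.Encircled.trans {n : ℕ} {p : KostantPicture n} {L L' L'' : Loop p}
    (h : L.Encircled L') (h' : L'.Encircled L'') : L.Encircled L'' := by
  have hl := h'.left_le.trans h.left_le
  have hr := h.right_le.trans h'.right_le
  by_cases he : L.1 = L''.1
  · have e1 : L.left = L''.left := congrArg (fun α : PosRoot n => α.1.1) he
    have e2 : L.right = L''.right := congrArg (fun α : PosRoot n => α.1.2) he
    have e3 : L.1 = L'.1 := Loop.root_eq (le_antisymm (e1 ▸ h'.left_le) h.left_le)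
      (le_antisymm h.right_le (e2 ▸ h'.right_le))
    refine Or.inr ⟨he, ?_⟩
    have k1 : (L.2 : ℕ) < L'.2 := h.elim (fun hh => absurd e3 hh.1) fun hh => hh.2
    have k2 : (L'.2 : ℕ) < L''.2 :=
      h'.elim (fun hh => absurd (e3.symm.trans he) hh.1) fun hh => hh.2
    exact k1.trans k2
  · exact Or.inl ⟨he, hl, hr⟩

theorem Loop.Encircled.irrefl {n : ℕ} {p : KostantPicture n} (L : Loop p) : ¬ L.Encircled L := by
  rintro (h | h)
  · exact h.1 rfl
  · exact lt_irrefl _ h.2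

theorem Loop.Encircled.passes {n : ℕ} {p : KostantPicture n} {L L' : Loop p}
    (h : L.Encircled L') {i : Fin n} (hi : L.Passes i) : L'.Passes i :=
  ⟨h.left_le.trans hi.1, hi.2.trans h.right_le⟩

theorem wellFounded_encircled {n : ℕ} (p : KostantPicture n) :
    WellFounded (Loop.Encircled (p := p)) :=
  have : IsTrans (Loop p) Loop.Encircled := ⟨fun _ _ _ => Loop.Encircled.trans⟩
  have : Std.Irrefl (Loop.Encircled (p := p)) := ⟨Loop.Encircled.irrefl⟩
  Finite.wellFounded_of_trans_of_irrefl _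

open scoped Classical in
/-- The greatest length of a chain of loops through the column `i` with greatest member `L`. -/
def height {n : ℕ} {p : KostantPicture n} (i : Fin n) : Loop p → ℕ :=
  (wellFounded_encircled p).fix fun L ih =>
    if L.Passes i then
      Finset.univ.sup (fun L' : Loop p => if h : L'.Encircled L then ih L' h else 0) + 1
    else 0

open scoped Classical in
theorem height_eq {n : ℕ} {p : KostantPicture n} (i : Fin n) (L : Loop p) :
    height i L = if L.Passes i then
      Finset.univ.sup (fun L' : Loop p => if L'.Encircled L then height i L' else 0) + 1
    else 0 := by
  rw [height, WellFounded.fix_eq]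
  rfl

theorem height_eq_zero {n : ℕ} {p : KostantPicture n} {i : Fin n} {L : Loop p}
    (h : ¬ L.Passes i) : height i L = 0 := by
  rw [height_eq, if_neg h]

theorem height_pos {n : ℕ} {p : KostantPicture n} {i : Fin n} {L : Loop p}
    (h : L.Passes i) : 0 < height i L := by
  rw [height_eq, if_pos h]
  exact Nat.succ_pos _

theorem height_lt {n : ℕ} {p : KostantPicture n} {i : Fin n} {L L' : Loop p}
    (h : L.Passes i) (hL : L'.Encircled L) : height i L' < height i L := by
  classical
  rw [height_eq i L, if_pos h, Nat.lt_succ_iff]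
  have := Finset.le_sup (f := fun L' : Loop p => if L'.Encircled L then height i L' else 0)
    (Finset.mem_univ L')
  simpa [hL] using this

/-- The supremum in the recursion is attained, either at the predecessor of `L` in a longest chain
or with value zero. -/
theorem height_eq_one_or {n : ℕ} {p : KostantPicture n} {i : Fin n} {L : Loop p}
    (h : L.Passes i) : height i L = 1 ∨
      ∃ L' : Loop p, L'.Encircled L ∧ L'.Passes i ∧ height i L' + 1 = height i L := by
  classical
  rw [height_eq i L, if_pos h]
  obtain ⟨L', -, hL'⟩ := Finset.exists_mem_eq_sup Finset.univ ⟨L, Finset.mem_univ L⟩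
    fun L' : Loop p => if L'.Encircled L then height i L' else 0
  rw [hL']
  by_cases h1 : L'.Encircled L
  · by_cases h2 : L'.Passes i
    · exact Or.inr ⟨L', h1, h2, by rw [if_pos h1]⟩
    · exact Or.inl (by rw [if_pos h1, height_eq_zero h2])
  · exact Or.inl (by rw [if_neg h1])

/-! ### Compatibility in terms of leading coefficients -/

theorem apply_eq_zero_of_mem_sup {α : Type*} {A : Submodule ℂ (α →₀ ℂ)} {s : Set (α →₀ ℂ)} {q : α}
    (hA : ∀ x ∈ A, x q = 0) (hs : ∀ x ∈ s, x q = 0) {x : α →₀ ℂ}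
    (hx : x ∈ A ⊔ Submodule.span ℂ s) : x q = 0 := by
  have : A ⊔ Submodule.span ℂ s ≤ LinearMap.ker (Finsupp.lapply (R := ℂ) (M := ℂ) q) :=
    sup_le hA (Submodule.span_le.2 hs)
  exact this hx

theorem torusPart_apply {n : ℕ} {Y : LoopGrassmannian n} {δ : Fin n → ℤ} (h : HasTorus Y δ)
    {x : X n} (hx : x ∈ torusPart Y.space) {i : Fin n} {j : ℤ} (hj : j < -δ i) : x (i, j) = 0 := by
  rw [torusPart_space h] at hx
  exact (Finsupp.mem_supported' ℂ x).1 hx _ fun h' => absurd h'.2 (not_le.2 hj)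

theorem apply_eq_zero_of_not_passes {n : ℕ} {p : KostantPicture n} {L : Loop p} {x : X n}
    (hx : x ∈ L.V) {i : Fin n} (hi : ¬ L.Passes i) (j : ℤ) : x (i, j) = 0 :=
  (Finsupp.mem_supported' ℂ x).1 hx _ hi

/-- The pole order of `y_L` in column `i` is at most the height: multiplication by `t` lowers it by
one, and `t y_L` is combined from the torus part and loops of smaller height. -/
theorem IsFlagBasis.apply_eq_zero {n : ℕ} {p : KostantPicture n} {Y : LoopGrassmannian n}
    {y : Loop p → X n} (hy : IsFlagBasis Y y) {δ : Fin n → ℤ} (h : HasTorus Y δ) (i : Fin n)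
    (L : Loop p) {j : ℤ} (hj : j < -δ i - height i L) : y L (i, j) = 0 := by
  induction L using (wellFounded_encircled p).induction generalizing j with
  | _ L ih =>
  by_cases hi : L.Passes i
  · have hpos := height_pos hi
    have := apply_eq_zero_of_mem_sup (q := (i, j + 1))
      (fun x hx => torusPart_apply h hx (by omega)) (by
        rintro _ ⟨L', hL', rfl⟩
        have := height_lt hi hL'
        exact ih L' hL' (by omega)) (hy.t_mem L)
    rwa [tMul_apply, add_sub_cancel_right] at this
  · exact apply_eq_zero_of_not_passes (hy.mem_V L) hi j

open scoped Classical in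
theorem proj_apply {n : ℕ} (i : Fin n) (x : X n) (q : Fin n × ℤ) :
    proj i x q = if q.1 = i then x q else 0 := by
  change (x.filter (· ∈ {q : Fin n × ℤ | q.1 = i})) q = _
  simp [Finsupp.filter_apply]

theorem proj_apply_self {n : ℕ} (i : Fin n) (x : X n) (j : ℤ) : proj i x (i, j) = x (i, j) := by
  simp [proj_apply]

/-- The span of the `t^j e_i` with `j ≥ -δ_i - m`. -/
def column {n : ℕ} (δ : Fin n → ℤ) (i : Fin n) (m : ℕ) : Submodule ℂ (X n) :=
  Finsupp.supported ℂ ℂ {q | q.1 = i ∧ -δ i - m ≤ q.2}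

theorem mem_column {n : ℕ} {δ : Fin n → ℤ} {i : Fin n} {m : ℕ} {x : X n} :
    x ∈ column δ i m ↔ proj i x = x ∧ ∀ j < -δ i - m, x (i, j) = 0 := by
  classical
  rw [column, Finsupp.mem_supported']
  constructor
  · intro hx
    refine ⟨?_, fun j hj => hx _ fun h => absurd h.2 (not_le.2 hj)⟩
    ext q
    rw [proj_apply]
    split_ifs with hq
    · rfl
    · exact (hx q fun h => hq h.1).symm
  · rintro ⟨h1, h2⟩ ⟨a, j⟩ hq
    by_cases ha : a = i
    · subst ha
      exact h2 j (not_le.1 fun hj => hq ⟨rfl, hj⟩)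
    · rw [← h1, proj_apply, if_neg ha]

theorem proj_mem_column {n : ℕ} {δ : Fin n → ℤ} {i : Fin n} {m : ℕ} {x : X n}
    (h : ∀ j < -δ i - m, x (i, j) = 0) : proj i x ∈ column δ i m := by
  classical
  refine mem_column.2 ⟨?_, fun j hj => by rw [proj_apply_self, h j hj]⟩
  ext q
  rw [proj_apply, proj_apply]
  split_ifs <;> rfl

theorem column_zero_le {n : ℕ} {p : KostantPicture n} {Y : LoopGrassmannian n} {δ : Fin n → ℤ}
    (h : HasTorus Y δ) {L : Loop p} {i : Fin n} (hi : L.Passes i) :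
    column δ i 0 ≤ (torusPart Y.space ⊓ L.V).map (proj i) := by
  intro x hx
  refine ⟨x, ⟨?_, ?_⟩, (mem_column.1 hx).1⟩
  · rw [torusPart_space h]
    refine Finsupp.supported_mono ?_ hx
    rintro q ⟨rfl, h2⟩
    exact ⟨trivial, by simpa using h2⟩
  · refine Finsupp.supported_mono ?_ hx
    rintro q ⟨rfl, h2⟩
    exact hi

theorem flag_mono {n : ℕ} {p : KostantPicture n} (Y : LoopGrassmannian n) (y : Loop p → X n)
    {L L' : Loop p} (hL : L'.Encircled L) : flag Y y L' ≤ flag Y y L := by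
  refine sup_le_sup (inf_le_inf_left _ (Finsupp.supported_mono fun q hq => ?_))
    (Submodule.span_mono (Set.image_mono ?_))
  · exact ⟨hL.left_le.trans hq.1, hq.2.trans hL.right_le⟩
  · rintro L'' (rfl | h)
    · exact Or.inr hL
    · exact Or.inr (h.trans hL)

theorem flag_le_flagInner {n : ℕ} {p : KostantPicture n} (Y : LoopGrassmannian n)
    (y : Loop p → X n) {L L' : Loop p} (hL : L'.Encircled L) : flag Y y L' ≤ flagInner Y y L :=
  le_sup_of_le_left (le_iSup₂_of_le L' hL le_rfl)

theorem flagInner_le_flag {n : ℕ} {p : KostantPicture n} (Y : LoopGrassmannian n)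
    (y : Loop p → X n) (L : Loop p) : flagInner Y y L ≤ flag Y y L :=
  sup_le (iSup₂_le fun _ hL' => flag_mono Y y hL') le_sup_left

theorem mem_flag {n : ℕ} {p : KostantPicture n} (Y : LoopGrassmannian n)
    (y : Loop p → X n) (L : Loop p) : y L ∈ flag Y y L :=
  Submodule.mem_sup_right (Submodule.subset_span ⟨L, Or.inl rfl, rfl⟩)

theorem flag_apply_eq_zero {n : ℕ} {p : KostantPicture n} {Y : LoopGrassmannian n} {δ : Fin n → ℤ}
    (h : HasTorus Y δ) {y : Loop p → X n} {L : Loop p} {i : Fin n} {j : ℤ} (hj : j < -δ i)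
    (hy : ∀ L' : Loop p, L' = L ∨ L'.Encircled L → y L' (i, j) = 0) {x : X n}
    (hx : x ∈ flag Y y L) : x (i, j) = 0 := by
  refine apply_eq_zero_of_mem_sup (A := torusPart Y.space ⊓ L.V)
    (fun x hx => torusPart_apply h hx.1 hj) ?_ hx
  rintro _ ⟨L', hL', rfl⟩
  exact hy L' hL'

theorem flagInner_apply_eq_zero {n : ℕ} {p : KostantPicture n} {Y : LoopGrassmannian n}
    {δ : Fin n → ℤ} (h : HasTorus Y δ) {y : Loop p → X n} {L : Loop p} {i : Fin n} {j : ℤ}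
    (hj : j < -δ i) (hy : ∀ L' : Loop p, L'.Encircled L → y L' (i, j) = 0) {x : X n}
    (hx : x ∈ flagInner Y y L) : x (i, j) = 0 := by
  have : flagInner Y y L ≤ LinearMap.ker (Finsupp.lapply (R := ℂ) (M := ℂ) (i, j)) := by
    refine sup_le (iSup₂_le fun L' hL' z hz => ?_) fun z hz => torusPart_apply h hz.1 hj
    refine flag_apply_eq_zero h hj ?_ hz
    rintro L'' (rfl | hL'')
    · exact hy _ hL'
    · exact hy _ (hL''.trans hL')
  exact this hx

/-- A longest chain through column `i` below `L` supplies every pole order up to the height, one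
loop for each order. -/
theorem IsFlagBasis.column_le_flag {n : ℕ} {p : KostantPicture n} {Y : LoopGrassmannian n}
    {y : Loop p → X n} (hy : IsFlagBasis Y y) {δ : Fin n → ℤ} (h : HasTorus Y δ) (i : Fin n)
    (L : Loop p) (hi : L.Passes i)
    (hL : ∀ L' : Loop p, L' = L ∨ L'.Encircled L → L'.Passes i →
      y L' (i, -δ i - height i L') ≠ 0) :
    column δ i (height i L) ≤ (flag Y y L).map (proj i) := by
  induction L using (wellFounded_encircled p).induction with
  | _ L ih =>
  have hpos := height_pos hi
  have hlow : column δ i (height i L - 1) ≤ (flag Y y L).map (proj i) := by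
    rcases height_eq_one_or hi with h1 | ⟨L', h1, h2, h3⟩
    · rw [h1]
      exact (column_zero_le h hi).trans (Submodule.map_mono le_sup_left)
    · rw [← h3, Nat.add_sub_cancel]
      refine (ih L' h1 h2 ?_).trans (Submodule.map_mono (flag_mono Y y h1))
      rintro L'' (rfl | h4)
      · exact hL _ (Or.inr h1)
      · exact hL _ (Or.inr (h4.trans h1))
  intro x hx
  have ha := hL L (Or.inl rfl) hi
  set a := y L (i, -δ i - height i L) with ha'
  have hxL := (mem_column.1 hx)
  -- Subtracting a multiple of `y_L` cancels the extreme term and leaves a vector already covered by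
  -- the predecessor of `L`.
  have hmem : x - (x (i, -δ i - height i L) / a) • proj i (y L) ∈
      column δ i (height i L - 1) := by
    have : x - (x (i, -δ i - height i L) / a) • proj i (y L) =
        proj i (x - (x (i, -δ i - height i L) / a) • y L) := by
      rw [map_sub, map_smul, hxL.1]
    rw [this]
    refine proj_mem_column fun j hj => ?_
    rw [Finsupp.sub_apply, Finsupp.smul_apply, smul_eq_mul]
    by_cases hj' : j < -δ i - height i L
    · rw [hxL.2 j hj', hy.apply_eq_zero h i L hj', mul_zero, sub_zero]
    · have : j = -δ i - height i L := by omega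
      rw [this, ← ha', div_mul_cancel₀ _ ha, sub_self]
  have := Submodule.add_mem _ (hlow hmem)
    (Submodule.smul_mem _ (x (i, -δ i - height i L) / a) (Submodule.mem_map_of_mem (mem_flag Y y L)))
  rwa [sub_add_cancel] at this

/-- The flag generated by `y` has the property required for compatibility if and only if every
`y_L` has a pole of the greatest possible order in every column that `L` passes through. -/
theorem IsFlagBasis.map_proj_ne_iff {n : ℕ} {p : KostantPicture n} {Y : LoopGrassmannian n}
    {y : Loop p → X n} (hy : IsFlagBasis Y y) {δ : Fin n → ℤ} (h : HasTorus Y δ) :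
    (∀ (L : Loop p) (i : Fin n), L.left ≤ i → i ≤ L.right →
      (flag Y y L).map (proj i) ≠ (flagInner Y y L).map (proj i)) ↔
    ∀ (L : Loop p) (i : Fin n), L.Passes i → y L (i, -δ i - height i L) ≠ 0 := by
  constructor
  · intro hne L i hi
    induction L using (wellFounded_encircled p).induction with
    | _ L ih =>
    intro h0
    have hpos := height_pos hi
    -- If the extreme coefficient of `y_L` vanished, `Y_L` would project into this smaller column,
    -- which `Y_L°` already fills.
    have hlow : column δ i (height i L - 1) ≤ (flagInner Y y L).map (proj i) := by
      rcases height_eq_one_or hi with h1 | ⟨L', h1, h2, h3⟩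
      · rw [h1]
        exact (column_zero_le h hi).trans (Submodule.map_mono le_sup_right)
      · rw [← h3, Nat.add_sub_cancel]
        refine (hy.column_le_flag h i L' h2 ?_).trans
          (Submodule.map_mono (flag_le_flagInner Y y h1))
        rintro L'' (rfl | h4)
        · exact ih _ h1
        · exact ih _ (h4.trans h1)
    refine hne L i hi.1 hi.2 (le_antisymm (le_trans ?_ hlow)
      (Submodule.map_mono (flagInner_le_flag Y y L)))
    rintro _ ⟨x, hx, rfl⟩
    refine proj_mem_column fun j hj => flag_apply_eq_zero h (by omega) ?_ hx
    rintro L' (rfl | hL')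
    · by_cases hj' : j < -δ i - height i L'
      · exact hy.apply_eq_zero h i L' hj'
      · rw [show j = -δ i - height i L' by omega, h0]
    · have := height_lt hi hL'
      exact hy.apply_eq_zero h i L' (by omega)
  · intro hne L i hl hr heq
    have hi : L.Passes i := ⟨hl, hr⟩
    have hpos := height_pos hi
    have h1 : proj i (y L) ∈ (flagInner Y y L).map (proj i) :=
      heq ▸ Submodule.mem_map_of_mem (mem_flag Y y L)
    obtain ⟨z, hz, hzy⟩ := h1
    refine hne L i hi ?_
    rw [← proj_apply_self, ← hzy, proj_apply_self]
    refine flagInner_apply_eq_zero h (by omega) (fun L' hL' => ?_) hz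
    have := height_lt hi hL'
    exact hy.apply_eq_zero h i L' (by omega)

/-- Compatibility in terms of the lattice alone. -/
theorem compatible_iff {n : ℕ} {p : KostantPicture n} {Y : LoopGrassmannian n} {δ : Fin n → ℤ}
    (h : HasTorus Y δ) (hp : ∀ α, loopCount Y α = p α) :
    Compatible Y p ↔ ∀ (L : Loop p) (i : Fin n), L.Passes i →
      ∃ x ∈ polarPart Y δ (Set.Icc L.left L.right), x (i, -δ i - height i L) ≠ 0 := by
  constructor
  · rintro ⟨y, hy, hne⟩ L i hi
    have hpos := height_pos hi
    refine ⟨trunc δ (y L), ⟨?_, ?_⟩, ?_⟩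
    · have h1 : y L ∈ Y.space := by
        rw [← hy.sup_eq]
        exact Submodule.mem_sup_right (Submodule.subset_span ⟨L, rfl⟩)
      have := Y.space.sub_mem h1 (supported_regular_le h _ (sub_trunc_mem δ (y L))).1
      rwa [sub_sub_cancel] at this
    · refine (Finsupp.mem_supported' ℂ _).2 fun q hq => ?_
      rw [trunc_apply]
      split_ifs with hq2
      · exact (Finsupp.mem_supported' ℂ _).1 (hy.mem_V L) q fun hq1 => hq ⟨hq1, hq2⟩
      · rfl
    · rw [trunc_apply, if_pos (by dsimp only; omega)]
      exact (hy.map_proj_ne_iff h).1 hne L i hi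
  · intro hx
    -- Any polar flag basis will do; no special choice is needed.
    obtain ⟨y, hy⟩ := exists_isPolarFlagBasis h hp
    have hyf := hy.isFlagBasis h
    refine ⟨y, hyf, (hyf.map_proj_ne_iff h).2 fun L i hi => ?_⟩
    have hpos := height_pos hi
    -- Among the loops around one root the induction goes from the outermost inward.
    induction hm : p L.1 - (L.2 : ℕ) using Nat.strong_induction_on generalizing L with
    | _ m ih =>
    intro h0
    have hle : ∀ L' : Loop p, ∀ j : ℤ, j ≤ -δ i - height i L →
        L' = L ∨ L'.Encircled L → y L' (i, j) = 0 := by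
      rintro L' j hj (rfl | hL')
      · rcases hj.lt_or_eq with hj | hj
        · exact hyf.apply_eq_zero h i L' hj
        · rw [hj, h0]
      · have := height_lt hi hL'
        exact hyf.apply_eq_zero h i L' (by omega)
    have hlt := L.2.isLt
    by_cases htop : (L.2 : ℕ) + 1 = p L.1
    -- For the outermost loop, the polar part of its columns is spanned by the `y_L'` with `L' ⊆ L`,
    -- all of which vanish at the extreme symbol by `hle`.
    · obtain ⟨x, hxm, hxne⟩ := hx L i hi
      refine hxne ?_
      rw [Icc_eq_interval, hy.polarPart_interval h hp L.right.isLt] at hxm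
      refine apply_eq_zero_of_mem_sup (A := ⊥) (fun x hx => ?_) ?_ (Submodule.mem_sup_right hxm)
      · rw [(Submodule.mem_bot ℂ).1 hx]
        rfl
      · rintro _ ⟨L', hL', rfl⟩
        refine hle L' _ le_rfl ?_
        have hmem := mem_loopsIn.1 hL'
        have hl : L.left ≤ L'.left := Fin.le_def.2 hmem.1
        have hr : L'.right ≤ L.right := Fin.le_def.2 (Nat.lt_succ_iff.1 hmem.2)
        by_cases he : L'.1 = L.1
        · obtain ⟨α, k⟩ := L
          obtain ⟨β, k'⟩ := L'
          obtain rfl : β = α := he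
          have hk' := k'.isLt
          dsimp only at htop
          by_cases hk : (k' : ℕ) = k
          · exact Or.inl (by rw [Fin.ext hk])
          · exact Or.inr (Or.inr ⟨rfl, by dsimp only; omega⟩)
        · exact Or.inr (Or.inl ⟨he, hl, hr⟩)
    · obtain ⟨α, k⟩ := L
      dsimp only at htop hlt hm
      -- For the next loop outward, `shift` sends its vector into the span of the `y_L'` with `L' ⊆
      -- L`. The vanishing in `hle` would kill its extreme coefficient, against the induction
      -- hypothesis.
      let L₁ : Loop p := ⟨α, ⟨k + 1, by omega⟩⟩
      have hL₁ : Loop.Encircled ⟨α, k⟩ L₁ := Or.inr ⟨rfl, Nat.lt_succ_self _⟩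
      have hi₁ : L₁.Passes i := hi
      have hh := height_lt hi₁ hL₁
      have h1 := ih (p α - (k + 1)) (by omega) L₁ hi₁ (height_pos hi₁) rfl
      apply h1
      have h2 := apply_eq_zero_of_mem_sup (A := ⊥) (q := (i, -δ i - height i L₁ + 1))
        (fun x hx => by rw [(Submodule.mem_bot ℂ).1 hx]; rfl) (by
          rintro _ ⟨L', hL', rfl⟩
          refine hle L' _ (by omega) ?_
          rcases hL' with hL' | ⟨hL', hk'⟩
          · exact Or.inr (Or.inl hL')
          · obtain ⟨β, k'⟩ := L'
            obtain rfl : β = α := hL'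
            change (k' : ℕ) < k + 1 at hk'
            by_cases hk : (k' : ℕ) = k
            · exact Or.inl (by rw [Fin.ext hk])
            · exact Or.inr (Or.inr ⟨rfl, by dsimp only; omega⟩))
        (Submodule.mem_sup_right (hy.shift_mem L₁))
      rwa [shift_apply, if_pos (by omega), add_sub_cancel_right] at h2

end

end LoopGr

namespace LoopGr

noncomputable section

/-! ### Openness -/

theorem exists_ne_zero_of_lt_finrank {V : Type*} [AddCommGroup V] [Module ℂ V]
    (W : Submodule ℂ V) [FiniteDimensional ℂ W] {d : ℕ} (g : Fin d → V →ₗ[ℂ] ℂ)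
    (hd : d < Module.finrank ℂ W) : ∃ x ∈ W, x ≠ 0 ∧ ∀ a, g a x = 0 := by
  have hker : LinearMap.ker (LinearMap.pi fun a => g a ∘ₗ W.subtype) ≠ ⊥ :=
    LinearMap.ker_ne_bot_of_finrank_lt (by rwa [Module.finrank_fin_fun])
  obtain ⟨⟨x, hx⟩, hxf, hx0⟩ := Submodule.exists_mem_ne_zero_of_ne_bot hker
  exact ⟨x, hx, fun h => hx0 (Subtype.ext h), fun a => congrFun (LinearMap.mem_ker.1 hxf) a⟩

/-- The vectors `K` of the polar part that vanish at `q₀` are separated by `dim K` coordinates `q`;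
let `A` be the remaining polar symbols other than `q₀`. If `q₀` vanished on a polar part of the same
dimension, the `dim K` conditions `x (q a) = 0` would leave a nonzero vector in it, supported on
`A`. -/
theorem exists_supported_disjoint {n : ℕ} {Y : LoopGrassmannian n} {δ : Fin n → ℤ}
    (S : Set (Fin n)) (q₀ : Fin n × ℤ) (hY : ∃ x ∈ polarPart Y δ S, x q₀ ≠ 0) :
    ∃ A : Set (Fin n × ℤ), Disjoint Y.space (Finsupp.supported ℂ ℂ A) ∧
      ∀ Y' : LoopGrassmannian n,
        Module.finrank ℂ (polarPart Y' δ S) = Module.finrank ℂ (polarPart Y δ S) →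
        Disjoint Y'.space (Finsupp.supported ℂ ℂ A) → ∃ x ∈ polarPart Y' δ S, x q₀ ≠ 0 := by
  let K : Submodule ℂ (X n) :=
    polarPart Y δ S ⊓ LinearMap.ker (Finsupp.lapply (R := ℂ) (M := ℂ) q₀)
  have hK : FiniteDimensional ℂ K := Submodule.finiteDimensional_of_le inf_le_left
  have hlt : Module.finrank ℂ K < Module.finrank ℂ (polarPart Y δ S) := by
    refine Submodule.finrank_lt_finrank_of_lt (lt_of_le_of_ne inf_le_left fun heq => ?_)
    obtain ⟨x, hx, hne⟩ := hY
    rw [← heq] at hx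
    exact hne hx.2
  obtain ⟨v, hv, hvK⟩ := exists_linearIndependent_span_eq K rfl
  obtain ⟨q, hq, hdet⟩ := exists_det_ne_zero_of_disjoint (s := (polar δ S \ {q₀})ᶜ) hv (by
    rw [hvK, Submodule.disjoint_def]
    intro x hx hx2
    have h1 := (Finsupp.mem_supported' ℂ x).1 hx.1.2
    have h2 := (Finsupp.mem_supported' ℂ x).1 hx2
    ext k
    by_cases hk : k ∈ polar δ S
    · by_cases hk0 : k = q₀
      · rw [hk0]
        exact hx.2
      · exact h2 k fun h => h ⟨hk, hk0⟩
    · exact h1 k hk)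
  refine ⟨(polar δ S \ {q₀}) \ Set.range q, ?_, fun Y' hdim hY' => ?_⟩
  · rw [Submodule.disjoint_def]
    intro x hx hx2
    have h2 := (Finsupp.mem_supported' ℂ x).1 hx2
    refine eq_zero_of_mem_span_of_det_ne_zero hdet ?_ fun a => h2 _ fun h => h.2 ⟨a, rfl⟩
    rw [hvK]
    exact ⟨⟨hx, Finsupp.supported_mono (fun k hk => hk.1.1) hx2⟩, h2 _ fun h => h.1.2 rfl⟩
  · by_contra! hzero
    obtain ⟨x, hx, hx0, hxf⟩ := exists_ne_zero_of_lt_finrank (polarPart Y' δ S)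
      (fun a => Finsupp.lapply (R := ℂ) (M := ℂ) (q a)) (hdim ▸ hlt)
    refine hx0 (Submodule.disjoint_def.1 hY' x hx.1 ?_)
    have h1 := (Finsupp.mem_supported' ℂ x).1 hx.2
    refine (Finsupp.mem_supported' ℂ x).2 fun k hk => ?_
    by_cases hkS : k ∈ polar δ S
    · by_cases hk0 : k = q₀
      · rw [hk0]
        exact hzero x hx
      · by_cases hkq : k ∈ Set.range q
        · obtain ⟨a, rfl⟩ := hkq
          exact hxf a
        · exact absurd ⟨⟨hkS, hk0⟩, hkq⟩ hk
    · exact h1 k hkS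

theorem isOpen_compatiblePiece {n : ℕ} (p : KostantPicture n) (lam : Fin n → ℤ) :
    IsOpen ((↑) ⁻¹' compatiblePiece p lam : Set (piece p lam)) := by
  rw [isOpen_iff_forall_mem_open]
  rintro ⟨Y, hYp⟩ ⟨-, hYc⟩
  obtain ⟨hT, hp⟩ := mem_piece_iff.1 hYp
  have hcond := (compatible_iff hT hp).1 hYc
  have hex : ∀ (L : Loop p) (i : Fin n), ∃ A : Set (Fin n × ℤ),
      Disjoint Y.space (Finsupp.supported ℂ ℂ A) ∧ ∀ Y' ∈ piece p lam,
        Disjoint Y'.space (Finsupp.supported ℂ ℂ A) → L.Passes i →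
        ∃ x ∈ polarPart Y' (fun i => lam i - numLeft p i) (Set.Icc L.left L.right),
          x (i, -(lam i - numLeft p i) - height i L) ≠ 0 := by
    intro L i
    by_cases hi : L.Passes i
    · obtain ⟨A, hA, hA'⟩ := exists_supported_disjoint _ _ (hcond L i hi)
      refine ⟨A, hA, fun Y' hY' hd _ => hA' Y' ?_ hd⟩
      obtain ⟨hT', hp'⟩ := mem_piece_iff.1 hY'
      rw [Icc_eq_interval, (loopCount_eq_iff hT' p).1 hp' _ _ L.right.isLt,
        (loopCount_eq_iff hT p).1 hp _ _ L.right.isLt]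
    -- Columns that `L` misses impose no condition; the empty set only makes `A` total.
    · exact ⟨∅, by simp, fun _ _ _ hi' => absurd hi' hi⟩
  choose A hA hA' using hex
  refine ⟨(↑) ⁻¹' ⋂ (L : Loop p) (i : Fin n),
    {Y : LoopGrassmannian n | Disjoint Y.space (Finsupp.supported ℂ ℂ (A L i))}, ?_, ?_, ?_⟩
  · rintro ⟨Y', hY'⟩ hU
    refine ⟨hY', ?_⟩
    obtain ⟨hT', hp'⟩ := mem_piece_iff.1 hY'
    refine (compatible_iff hT' hp').2 fun L i hi => hA' L i Y' hY' ?_ hi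
    exact Set.mem_iInter₂.1 hU L i
  · exact (isOpen_iInter_of_finite fun L => isOpen_iInter_of_finite fun i =>
      isOpen_disjoint_supported _).preimage continuous_subtype_val
  · exact Set.mem_iInter₂.2 fun L i => hA L i

end

end LoopGr

namespace LoopGr

noncomputable section

open Filter Polynomial

/-! ### Lattices from structure constants -/

/-- The structure constants of a flag: the matrix of `t` on the basis `y_L`, and the residues
of the `y_L` in the columns. -/
@[ext]
structure FlagData {n : ℕ} (p : KostantPicture n) (R : Type*) [CommSemiring R] where
  /-- the matrix of `t` -/
  mat : Matrix (Loop p) (Loop p) R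
  /-- the residues -/
  res : Fin n → Loop p → R
  mat_eq_zero : ∀ L L' : Loop p, ¬ L'.Encircled L → mat L L' = 0
  res_eq_zero : ∀ (i : Fin n) (L : Loop p), ¬ L.Passes i → res i L = 0

namespace FlagData

variable {n : ℕ} {p : KostantPicture n} {R S : Type*} [CommSemiring R] [CommSemiring S]

/-- Change of scalars. -/
@[simps]
def map (f : R →+* S) (D : FlagData p R) : FlagData p S where
  mat := D.mat.map f
  res i L := f (D.res i L)
  mat_eq_zero L L' h := by simp [D.mat_eq_zero L L' h]
  res_eq_zero i L h := by simp [D.res_eq_zero i L h]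

/-- The coefficient of `y_L` at the symbol in column `i` with pole order `k + 1`. -/
def coef (D : FlagData p R) (i : Fin n) : ℕ → Loop p → R
  | 0 => D.res i
  | k + 1 => D.mat.mulVec (D.coef i k)

theorem coef_succ (D : FlagData p R) (i : Fin n) (k : ℕ) (L : Loop p) :
    D.coef i (k + 1) L = ∑ L', D.mat L L' * D.coef i k L' := rfl

theorem coef_map (f : R →+* S) (D : FlagData p R) (i : Fin n) (k : ℕ) (L : Loop p) :
    (D.map f).coef i k L = f (D.coef i k L) := by
  induction k generalizing L with
  | zero => rfl
  | succ k ih => simp [coef_succ, ih]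

/-- The coefficient is a weighted sum over descending chains of `k + 1` loops through column `i`
starting at `L`, and there are none once `k` reaches the height. -/
theorem coef_eq_zero (D : FlagData p R) {i : Fin n} {k : ℕ} {L : Loop p}
    (h : height i L ≤ k) : D.coef i k L = 0 := by
  induction k generalizing L with
  | zero =>
    refine D.res_eq_zero i L fun hi => ?_
    have := height_pos hi
    omega
  | succ k ih =>
    rw [coef_succ]
    refine Finset.sum_eq_zero fun L' _ => ?_
    by_cases hL : L'.Encircled L
    · rw [ih, mul_zero]
      by_cases hi : L.Passes i
      · have := height_lt hi hL
        omega
      · rw [height_eq_zero fun h' => hi (hL.passes h')]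
        exact Nat.zero_le _
    · rw [D.mat_eq_zero L L' hL, zero_mul]

/-- The coefficient of `y_L` at a symbol. -/
def entry (D : FlagData p R) (δ : Fin n → ℤ) (L : Loop p) (q : Fin n × ℤ) : R :=
  if q.2 < -δ q.1 then D.coef q.1 (-δ q.1 - 1 - q.2).toNat L else 0

theorem entry_map (f : R →+* S) (D : FlagData p R) (δ : Fin n → ℤ) (L : Loop p) (q : Fin n × ℤ) :
    (D.map f).entry δ L q = f (D.entry δ L q) := by
  rw [entry, entry]
  split_ifs
  · exact coef_map f D _ _ L
  · rw [map_zero]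

theorem entry_eq_zero (D : FlagData p R) (δ : Fin n → ℤ) (L : Loop p) {q : Fin n × ℤ}
    (h : q.2 < -δ q.1 - height q.1 L) : D.entry δ L q = 0 := by
  rw [entry]
  split_ifs
  · exact D.coef_eq_zero (by omega)
  · rfl

/-- The vector `y_L` with the given structure constants. -/
def vec (D : FlagData p ℂ) (δ : Fin n → ℤ) (L : Loop p) : X n :=
  Finsupp.onFinset
    (Finset.univ.biUnion fun i : Fin n =>
      (Finset.Ico (-δ i - height i L) (-δ i)).map ⟨fun j => (i, j), fun _ _ h => (Prod.mk.inj h).2⟩)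
    (D.entry δ L) fun q hq => by
      simp only [Finset.mem_biUnion, Finset.mem_univ, Finset.mem_map, Finset.mem_Ico,
        true_and]
      refine ⟨q.1, q.2, ⟨?_, ?_⟩, rfl⟩
      · by_contra h
        exact hq (D.entry_eq_zero δ L (not_le.1 h))
      · by_contra h
        exact hq (if_neg h)

theorem vec_apply (D : FlagData p ℂ) (δ : Fin n → ℤ) (L : Loop p) (q : Fin n × ℤ) :
    D.vec δ L q = D.entry δ L q := rfl

theorem vec_apply_pole (D : FlagData p ℂ) (δ : Fin n → ℤ) (L : Loop p) (i : Fin n) (k : ℕ) :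
    D.vec δ L (i, -δ i - 1 - k) = D.coef i k L := by
  rw [vec_apply, entry, if_pos (by dsimp only; omega)]
  congr
  dsimp only
  omega

theorem vec_mem_V (D : FlagData p ℂ) (δ : Fin n → ℤ) (L : Loop p) : D.vec δ L ∈ L.V := by
  refine (Finsupp.mem_supported' ℂ _).2 fun q hq => ?_
  rw [vec_apply]
  by_cases h : q.2 < -δ q.1
  · refine D.entry_eq_zero δ L ?_
    rw [height_eq_zero hq]
    simpa using h
  · exact if_neg h

theorem vec_mem_polar (D : FlagData p ℂ) (δ : Fin n → ℤ) (L : Loop p) :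
    D.vec δ L ∈ Finsupp.supported ℂ ℂ (polar δ Set.univ) :=
  (Finsupp.mem_supported' ℂ _).2 fun _ hq => if_neg fun h => hq ⟨trivial, h⟩

/-- The recursion defining `coef` is this identity read coefficientwise. -/
theorem shift_vec (D : FlagData p ℂ) (δ : Fin n → ℤ) (L : Loop p) :
    shift δ (D.vec δ L) = ∑ L', D.mat L L' • D.vec δ L' := by
  ext ⟨i, j⟩
  rw [shift_apply, Finsupp.finsetSum_apply]
  simp only [Finsupp.smul_apply, smul_eq_mul]
  split_ifs with hj
  · obtain ⟨k, rfl⟩ : ∃ k : ℕ, j = -δ i - 1 - k := ⟨(-δ i - 1 - j).toNat, by omega⟩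
    have := D.vec_apply_pole δ L i (k + 1)
    push_cast at this
    rw [show -δ i - 1 - (k : ℤ) - 1 = -δ i - 1 - (k + 1) by ring, this, coef_succ]
    simp only [vec_apply_pole]
  · refine (Finset.sum_eq_zero fun L' _ => ?_).symm
    rw [vec_apply, entry, if_neg hj, mul_zero]

theorem shift_vec_mem (D : FlagData p ℂ) (δ : Fin n → ℤ) (L : Loop p) :
    shift δ (D.vec δ L) ∈ Submodule.span ℂ (D.vec δ '' {L' | L'.Encircled L}) := by
  rw [shift_vec]
  refine Submodule.sum_mem _ fun L' _ => ?_
  by_cases h : L'.Encircled L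
  · exact Submodule.smul_mem _ _ (Submodule.subset_span ⟨L', h, rfl⟩)
  · rw [D.mat_eq_zero L L' h, zero_smul]
    exact Submodule.zero_mem _

/-- The span of the `t^j e_i`, `j ≥ -δ_i`, and of the `y_L`. -/
def carrier (D : FlagData p ℂ) (δ : Fin n → ℤ) : Submodule ℂ (X n) :=
  Finsupp.supported ℂ ℂ (regular δ Set.univ) ⊔ Submodule.span ℂ (Set.range (D.vec δ))

/-- Heights depend only on `p`, so one `N` serves all structure constants and families of lattices
stay in one finite part. -/
theorem exists_bound (p : KostantPicture n) (δ : Fin n → ℤ) : ∃ N : ℕ, (∀ i, -δ i ≤ N) ∧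
    ∀ D : FlagData p ℂ, tX0 n N ≤ D.carrier δ ∧ D.carrier δ ≤ tX0 n (-N) := by
  obtain ⟨N₁, hN₁⟩ := Set.finite_range (fun i : Fin n => (δ i).natAbs) |>.bddAbove
  obtain ⟨N₂, hN₂⟩ := Set.finite_range
    (fun a : Fin n × Loop p => (δ a.1).natAbs + height a.1 a.2) |>.bddAbove
  refine ⟨N₁ + N₂, fun i => ?_, fun D => ⟨le_sup_of_le_left (Finsupp.supported_mono fun q hq => ?_),
    sup_le (Finsupp.supported_mono fun q hq => ?_) (Submodule.span_le.2 ?_)⟩⟩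
  · have := hN₁ ⟨i, rfl⟩
    dsimp only at this
    push_cast
    omega
  · have := hN₁ ⟨q.1, rfl⟩
    dsimp only at this
    have h2 : ((N₁ + N₂ : ℕ) : ℤ) ≤ q.2 := hq
    exact ⟨trivial, by omega⟩
  · have := hN₁ ⟨q.1, rfl⟩
    dsimp only at this
    have h2 := hq.2
    change -((N₁ + N₂ : ℕ) : ℤ) ≤ q.2
    omega
  · rintro _ ⟨L, rfl⟩
    refine (Finsupp.mem_supported' ℂ _).2 fun q hq => D.entry_eq_zero δ L ?_
    have := hN₂ ⟨(q.1, L), rfl⟩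
    dsimp only at this
    have h2 : ¬ -((N₁ + N₂ : ℕ) : ℤ) ≤ q.2 := hq
    omega

/-- The lattice with the given torus part and structure constants. -/
def lattice (D : FlagData p ℂ) (δ : Fin n → ℤ) : LoopGrassmannian n where
  space := D.carrier δ
  t_mem y hy := by
    suffices D.carrier δ ≤ (D.carrier δ).comap (tMul n) from this hy
    refine sup_le ?_ (Submodule.span_le.2 ?_)
    · intro x hx
      refine Submodule.mem_sup_left ((Finsupp.mem_supported' ℂ _).2 ?_)
      rintro ⟨i, j⟩ hq
      rw [tMul_apply]
      refine (Finsupp.mem_supported' ℂ _).1 hx _ fun h => hq ⟨trivial, ?_⟩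
      have := h.2
      dsimp only at this ⊢
      omega
    · rintro _ ⟨L, rfl⟩
      rw [SetLike.mem_coe, Submodule.mem_comap, ← sub_add_cancel (tMul n _) (trunc δ (tMul n _))]
      exact Submodule.add_mem_sup (sub_trunc_mem _ _)
        (Submodule.span_mono (Set.image_subset_range _ _) (D.shift_vec_mem δ L))
  bounded := (exists_bound p δ).imp fun _ hN => hN.2 D

theorem polarPart_lattice (D : FlagData p ℂ) (δ : Fin n → ℤ) :
    polarPart (D.lattice δ) δ Set.univ = Submodule.span ℂ (Set.range (D.vec δ)) := by
  have h1 : Submodule.span ℂ (Set.range (D.vec δ)) ≤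
      Finsupp.supported ℂ ℂ (polar δ Set.univ) := by
    rw [Submodule.span_le]
    rintro _ ⟨L, rfl⟩
    exact D.vec_mem_polar δ L
  have h2 : Disjoint (regular δ Set.univ) (polar δ Set.univ) := by
    rw [Set.disjoint_left]
    exact fun q h1 h2 => absurd h1.2 (not_le.2 h2.2)
  change (Finsupp.supported ℂ ℂ (regular δ Set.univ) ⊔ Submodule.span ℂ (Set.range (D.vec δ))) ⊓
    Finsupp.supported ℂ ℂ (polar δ Set.univ) = _
  rw [sup_comm, sup_inf_assoc_of_le _ h1,
    (Finsupp.disjoint_supported_supported h2).eq_bot, sup_bot_eq]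

/-- For every interval of columns, the `y_L` with `L` not inside the interval are independent in
the remaining columns. -/
def IsGeneric (D : FlagData p ℂ) (δ : Fin n → ℤ) : Prop :=
  ∀ a b : ℕ, b ≤ n → LinearIndependent ℂ
    fun (L : {L // L ∉ loopsIn p a b}) (q : {q : Fin n × ℤ // q.1 ∉ interval n a b}) =>
      D.entry δ L.1 q.1

theorem IsGeneric.linearIndependent {D : FlagData p ℂ} {δ : Fin n → ℤ} (hD : D.IsGeneric δ) :
    LinearIndependent ℂ (D.vec δ) := by
  -- The empty interval contains no loop and removes no column.
  have h := hD 0 0 (Nat.zero_le n)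
  have h2 : LinearIndependent ℂ fun L : {L // L ∉ loopsIn p 0 0} => D.vec δ L.1 :=
    LinearIndependent.of_comp (LinearMap.funLeft ℂ ℂ
      (Subtype.val : {q : Fin n × ℤ // q.1 ∉ interval n 0 0} → _) ∘ₗ Finsupp.lcoeFun) h
  have he : ∀ L : Loop p, L ∉ loopsIn p 0 0 := fun L hL => by
    rw [loopsIn_eq_empty p (by omega)] at hL
    simp at hL
  exact h2.comp (fun L => ⟨L, he L⟩) fun L L' h => congrArg Subtype.val h

/-- Outside the interval only loops not contained in it contribute, and genericity makes their
coefficients zero when the total vanishes there. -/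
theorem IsGeneric.polarPart_interval {D : FlagData p ℂ} {δ : Fin n → ℤ} (hD : D.IsGeneric δ)
    {a b : ℕ} (hb : b ≤ n) : polarPart (D.lattice δ) δ (interval n a b) =
      Submodule.span ℂ (D.vec δ '' (loopsIn p a b : Set (Loop p))) := by
  classical
  rw [← inf_supported_polar, polarPart_lattice]
  refine le_antisymm ?_ (le_inf (Submodule.span_mono (Set.image_subset_range _ _)) ?_)
  · rintro x ⟨hx1, hx2⟩
    obtain ⟨c, rfl⟩ := (Submodule.mem_span_range_iff_exists_fun ℂ).1 hx1
    have hc := Fintype.linearIndependent_iff.1 (hD a b hb) (fun L => c L.1) (by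
      funext q
      have h0 := (Finsupp.mem_supported' ℂ _).1 hx2 q.1 q.2
      rw [Finsupp.finsetSum_apply, ← Finset.sum_subset (Finset.subset_univ (loopsIn p a b)ᶜ),
        Finset.sum_subtype (p := fun L => L ∉ loopsIn p a b) _ (by simp)] at h0
      · rw [Finset.sum_apply, Pi.zero_apply, ← h0]
        rfl
      · intro L _ hL
        rw [Finset.mem_compl, not_not] at hL
        rw [Finsupp.smul_apply, (Finsupp.mem_supported' ℂ _).1
          (Loop.V_le_cols hL (D.vec_mem_V δ L)) q.1 q.2, smul_zero])
    refine Submodule.sum_mem _ fun L _ => ?_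
    by_cases hL : L ∈ loopsIn p a b
    · exact Submodule.smul_mem _ _ (Submodule.subset_span ⟨L, hL, rfl⟩)
    · rw [hc ⟨L, hL⟩, zero_smul]
      exact Submodule.zero_mem _
  · rw [Submodule.span_le]
    rintro _ ⟨L, hL, rfl⟩
    exact Loop.V_le_cols hL (D.vec_mem_V δ L)

/-- No loop fits into one column, so the polar part of a single column is zero and contains no
further symbol. -/
theorem IsGeneric.hasTorus {D : FlagData p ℂ} {δ : Fin n → ℤ} (hD : D.IsGeneric δ) :
    HasTorus (D.lattice δ) δ := by
  intro i j
  constructor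
  · intro h
    by_contra hj
    have hmem : tE i j ∈ polarPart (D.lattice δ) δ (interval n i (i + 1)) :=
      ⟨h, Finsupp.single_mem_supported ℂ 1 ⟨⟨le_rfl, Nat.lt_succ_self _⟩, not_le.1 hj⟩⟩
    rw [hD.polarPart_interval i.isLt, loopsIn_eq_empty p le_rfl, Finset.coe_empty,
      Set.image_empty, Submodule.span_empty, Submodule.mem_bot] at hmem
    simp [tE] at hmem
  · intro h
    exact Submodule.mem_sup_left (Finsupp.single_mem_supported ℂ 1 ⟨trivial, h⟩)

theorem IsGeneric.loopCount_eq {D : FlagData p ℂ} {δ : Fin n → ℤ} (hD : D.IsGeneric δ)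
    (α : PosRoot n) : loopCount (D.lattice δ) α = p α :=
  (loopCount_eq_iff hD.hasTorus p).2 (fun a b hb => by
    rw [hD.polarPart_interval hb, finrank_span_image hD.linearIndependent]) α

theorem IsGeneric.isPolarFlagBasis {D : FlagData p ℂ} {δ : Fin n → ℤ} (hD : D.IsGeneric δ) :
    IsPolarFlagBasis (D.lattice δ) δ (D.vec δ) where
  linearIndependent := hD.linearIndependent
  span_eq := (D.polarPart_lattice δ).symm
  mem_V := D.vec_mem_V δ
  shift_mem := D.shift_vec_mem δ

/-- Every lattice with Kostant picture `p` arises from generic structure constants. -/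
theorem exists_lattice_eq {Y : LoopGrassmannian n} {δ : Fin n → ℤ} (h : HasTorus Y δ)
    (hp : ∀ α, loopCount Y α = p α) :
    ∃ D : FlagData p ℂ, D.IsGeneric δ ∧ D.lattice δ = Y := by
  classical
  obtain ⟨y, hy⟩ := exists_isPolarFlagBasis h hp
  have hex : ∀ L : Loop p, ∃ c : Loop p → ℂ, (∀ L', ¬ L'.Encircled L → c L' = 0) ∧
      ∑ L', c L' • y L' = shift δ (y L) := fun L => by
    obtain ⟨c, hc, hcy⟩ := (Finsupp.mem_span_image_iff_linearCombination ℂ).1 (hy.shift_mem L)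
    refine ⟨c, fun L' hL' => (Finsupp.mem_supported' ℂ c).1 hc L' hL', ?_⟩
    rw [← hcy, Finsupp.linearCombination_apply, Finsupp.sum_fintype _ _ (by simp)]
  choose c hc hcy using hex
  let D : FlagData p ℂ :=
    { mat := c
      res := fun i L => y L (i, -δ i - 1)
      mat_eq_zero := hc
      res_eq_zero := fun i L hi => apply_eq_zero_of_not_passes (hy.mem_V L) hi _ }
  -- The matrix of `shift` and the residues determine all deeper coefficients, since `shift` moves
  -- each coefficient up by one.
  have hcoef : ∀ (k : ℕ) (i : Fin n) (L : Loop p), y L (i, -δ i - 1 - k) = D.coef i k L := by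
    intro k i
    induction k with
    | zero =>
      intro L
      simp only [Nat.cast_zero, sub_zero]
      rfl
    | succ k ih =>
      intro L
      have h1 := DFunLike.congr_fun (hcy L) (i, -δ i - 1 - k)
      rw [shift_apply, if_pos (by omega), Finsupp.finsetSum_apply] at h1
      rw [coef_succ, show -δ i - 1 - ((k + 1 : ℕ) : ℤ) = -δ i - 1 - k - 1 by push_cast; ring, ← h1]
      refine Finset.sum_congr rfl fun L' _ => ?_
      rw [Finsupp.smul_apply, ih L', smul_eq_mul]
  have hvec : D.vec δ = y := by
    funext L
    ext ⟨i, j⟩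
    by_cases hj : j < -δ i
    · obtain ⟨k, rfl⟩ : ∃ k : ℕ, j = -δ i - 1 - k := ⟨(-δ i - 1 - j).toNat, by omega⟩
      rw [vec_apply_pole, hcoef]
    · rw [vec_apply, entry, if_neg hj]
      have h1 : y L ∈ polarPart Y δ Set.univ := hy.span_eq ▸ Submodule.subset_span ⟨L, rfl⟩
      exact ((Finsupp.mem_supported' ℂ _).1 h1.2 _ fun h' => hj h'.2).symm
  refine ⟨D, fun a b hb => ?_, ?_⟩
  · let f : X n →ₗ[ℂ] ({q : Fin n × ℤ // q.1 ∉ interval n a b} → ℂ) :=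
      LinearMap.funLeft ℂ ℂ Subtype.val ∘ₗ Finsupp.lcoeFun
    have h1 : LinearIndependent ℂ fun L : {L // L ∉ loopsIn p a b} => y L.1 :=
      hy.linearIndependent.comp _ Subtype.val_injective
    -- A combination of outside loops that vanishes off the interval lies in its polar part, the
    -- span of the inside loops, and is zero by independence.
    have h2 := h1.map (f := f) (by
      rw [Submodule.disjoint_def]
      intro x hx hfx
      have hd := hy.linearIndependent.disjoint_span_image
        (s := {L | L ∉ loopsIn p a b}) (t := (loopsIn p a b : Set (Loop p)))
        (Set.disjoint_left.2 fun L h1 h2 => h1 h2)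
      refine Submodule.disjoint_def.1 hd x ?_ ?_
      · refine Submodule.span_mono ?_ hx
        rintro _ ⟨L, rfl⟩
        exact ⟨L.1, L.2, rfl⟩
      · rw [← hy.polarPart_interval h hp hb, ← inf_supported_polar]
        refine ⟨?_, (Finsupp.mem_supported' ℂ _).2 fun q hq =>
          congrFun (LinearMap.mem_ker.1 hfx) ⟨q, hq⟩⟩
        rw [← hy.span_eq]
        refine Submodule.span_mono ?_ hx
        rintro _ ⟨L, rfl⟩
        exact ⟨L.1, rfl⟩)
    rw [← hvec] at h2
    exact h2
  · refine LoopGrassmannian.ext ?_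
    change Finsupp.supported ℂ ℂ (regular δ Set.univ) ⊔ Submodule.span ℂ (Set.range (D.vec δ)) = _
    rw [hvec, ← torusPart_space h]
    exact (hy.isFlagBasis h).sup_eq

end FlagData

end

end LoopGr

namespace LoopGr

noncomputable section

open Filter Polynomial

namespace FlagData

variable {n : ℕ} {p : KostantPicture n}

/-! ### Density -/

/-- Here `N`, `d` and `e` precede `D`: a family of structure constants gets frames of one fixed
shape, polynomial when the constants are. -/
theorem exists_isFrame_lattice (p : KostantPicture n) (δ : Fin n → ℤ) :
    ∃ (N d : ℕ) (e : Fin d ≃ Loop p ⊕ {q : Fin n × ℤ // q ∈ box n N ∩ regular δ Set.univ}),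
      ∀ D : FlagData p ℂ, LinearIndependent ℂ (D.vec δ) →
        D.lattice δ ∈ finitePart n N d ∧
        IsFrame N (D.lattice δ) fun a =>
          Sum.elim (D.vec δ) (fun q => Finsupp.single q.1 1) (e a) := by
  obtain ⟨N, hNδ, hN⟩ := exists_bound p δ
  have hfin : Finite {q : Fin n × ℤ // q ∈ box n N ∩ regular δ Set.univ} :=
    (finite_box n N).inter_of_left _
  obtain ⟨d, ⟨e⟩⟩ := Finite.exists_equiv_fin
    (Loop p ⊕ {q : Fin n × ℤ // q ∈ box n N ∩ regular δ Set.univ})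
  refine ⟨N, d, e.symm, fun D hD => ?_⟩
  have hsingle : Submodule.span ℂ (Set.range fun q : {q : Fin n × ℤ //
      q ∈ box n N ∩ regular δ Set.univ} => (Finsupp.single q.1 1 : X n)) =
      Finsupp.supported ℂ ℂ (box n N ∩ regular δ Set.univ) := by
    rw [Finsupp.supported_eq_span_single]
    congr 1
    ext x
    simp
  have hpol : Submodule.span ℂ (Set.range (D.vec δ)) = polarPart (D.lattice δ) δ Set.univ :=
    (D.polarPart_lattice δ).symm
  have hT : Finsupp.supported ℂ ℂ (regular δ Set.univ) ≤ (D.lattice δ).space := le_sup_left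
  have hbox : polarPart (D.lattice δ) δ Set.univ ≤ Finsupp.supported ℂ ℂ (box n N) := by
    intro x hx
    have h1 := (Finsupp.mem_supported' ℂ _).1 ((hN D).2 hx.1)
    have h2 := (Finsupp.mem_supported' ℂ _).1 hx.2
    refine (Finsupp.mem_supported' ℂ _).2 fun q hq => ?_
    by_cases hq1 : -(N : ℤ) ≤ q.2
    · refine h2 q fun hq2 => hq ⟨hq1, ?_⟩
      exact hq2.2.trans_le (hNδ q.1)
    · exact h1 q hq1
  have hframe : IsFrame N (D.lattice δ) fun a =>
      Sum.elim (D.vec δ) (fun q => Finsupp.single q.1 1) (e.symm a) := by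
    constructor
    · refine LinearIndependent.comp ?_ e.symm e.symm.injective
      refine LinearIndependent.sum_type hD ?_ ?_
      · exact (Finsupp.linearIndependent_single_one ℂ (Fin n × ℤ)).comp _ Subtype.val_injective
      · rw [hsingle, hpol]
        refine (Finsupp.disjoint_supported_supported ?_).mono_left inf_le_right
        rw [Set.disjoint_left]
        exact fun q h1 h2 => absurd h2.2.2 (not_le.2 h1.2)
    · rw [show (fun a => Sum.elim (D.vec δ) (fun q : {q : Fin n × ℤ //
          q ∈ box n N ∩ regular δ Set.univ} => (Finsupp.single q.1 1 : X n)) (e.symm a)) =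
          Sum.elim (D.vec δ) (fun q => Finsupp.single q.1 1) ∘ e.symm from rfl,
        e.symm.surjective.range_comp, Set.Sum.elim_range, Submodule.span_union, hsingle, hpol]
      refine le_antisymm (sup_le (le_inf inf_le_left hbox) (le_inf ?_ ?_)) ?_
      · exact (Finsupp.supported_mono Set.inter_subset_right).trans hT
      · exact Finsupp.supported_mono Set.inter_subset_left
      · rintro x ⟨hx1, hx2⟩
        have h1 := sub_trunc_mem δ x
        have h2 : trunc δ x ∈ polarPart (D.lattice δ) δ Set.univ := by
          refine ⟨?_, (Finsupp.mem_supported' ℂ _).2 fun q hq => ?_⟩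
          · have := (D.lattice δ).space.sub_mem hx1 (hT h1)
            rwa [sub_sub_cancel] at this
          · rw [trunc_apply, if_neg fun h => hq ⟨trivial, h⟩]
        rw [← add_sub_cancel (trunc δ x) x]
        refine Submodule.add_mem_sup h2 ?_
        rw [Finsupp.supported_inter]
        exact ⟨Submodule.sub_mem _ hx2 (hbox h2), h1⟩
  refine ⟨⟨(hN D).1, (hN D).2, ?_⟩, hframe⟩
  rw [← hframe.2, finrank_span_eq_card hframe.1, Fintype.card_fin]

/-! ### One-parameter families of structure constants -/

theorem interval_eq_empty {n a b : ℕ} (h : b ≤ a) : interval n a b = ∅ :=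
  Set.eq_empty_of_forall_notMem fun _ hi => (hi.2.trans_le h).not_ge hi.1

/-- Genericity is an open condition on structure constants. -/
theorem eventually_isGeneric (D : FlagData p ℂ[X]) (δ : Fin n → ℤ) {a : ℂ}
    (ha : (D.map (evalRingHom a)).IsGeneric δ) :
    ∀ᶠ s in cofinite, (D.map (evalRingHom s)).IsGeneric δ := by
  have h : ∀ (x y : Fin (n + 1)), ∀ᶠ s in cofinite, LinearIndependent ℂ
      fun (L : {L // L ∉ loopsIn p x y}) (q : {q : Fin n × ℤ // q.1 ∉ interval n x y}) =>
        (D.map (evalRingHom s)).entry δ L.1 q.1 := by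
    intro x y
    have h1 := ha x y (Nat.lt_succ_iff.1 y.isLt)
    simp only [entry_map, coe_evalRingHom] at h1
    simp only [entry_map, coe_evalRingHom]
    exact eventually_linearIndependent
      (fun (L : {L // L ∉ loopsIn p x y}) (q : {q : Fin n × ℤ // q.1 ∉ interval n x y}) =>
        D.entry δ L.1 q.1) h1
  filter_upwards [eventually_all.2 fun x => eventually_all.2 (h x)] with s hs x y hy
  by_cases hx : x ≤ n
  · exact hs ⟨x, Nat.lt_succ_iff.2 hx⟩ ⟨y, Nat.lt_succ_iff.2 hy⟩
  -- For `x > n` the interval is empty, so the condition is the one at `x = n`; thus finitely many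
  -- intervals suffice.
  · have h1 := hs (Fin.last n) ⟨y, Nat.lt_succ_iff.2 hy⟩
    rw [Fin.val_last, loopsIn_eq_empty p (by omega), interval_eq_empty (by omega)] at h1
    rwa [loopsIn_eq_empty p (by omega), interval_eq_empty (by omega)]

open scoped Classical in
/-- The structure constants that are all one. -/
def ones (p : KostantPicture n) : FlagData p ℕ where
  mat L L' := if L'.Encircled L then 1 else 0
  res i L := if L.Passes i then 1 else 0
  mat_eq_zero _ _ h := if_neg h
  res_eq_zero _ _ h := if_neg h

/-- With all constants one, the extreme coefficient counts the chains of greatest length, and over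
`ℕ` nothing cancels. -/
theorem ones_coef_pos {i : Fin n} {L : Loop p} (hi : L.Passes i) :
    0 < (ones p).coef i (height i L - 1) L := by
  induction L using (wellFounded_encircled p).induction with
  | _ L ih =>
  rcases height_eq_one_or hi with h | ⟨L', h1, h2, h3⟩
  · rw [h]
    change 0 < (ones p).res i L
    simp [ones, hi]
  · have hpos := height_pos h2
    rw [← h3, Nat.add_sub_cancel, show height i L' = height i L' - 1 + 1 by omega, coef_succ]
    refine lt_of_lt_of_le ?_ (Finset.single_le_sum (fun _ _ => Nat.zero_le _) (Finset.mem_univ L'))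
    refine Nat.mul_pos ?_ (ih L' h1 h2)
    simp [ones, h1]

/-- The line through `D` and the structure constants that are all one. -/
def line (D : FlagData p ℂ) : FlagData p ℂ[X] where
  mat L L' := (1 - Polynomial.X) * C (D.mat L L') + Polynomial.X * ((ones p).mat L L' : ℂ[X])
  res i L := (1 - Polynomial.X) * C (D.res i L) + Polynomial.X * ((ones p).res i L : ℂ[X])
  mat_eq_zero L L' h := by simp [D.mat_eq_zero L L' h, (ones p).mat_eq_zero L L' h]
  res_eq_zero i L h := by simp [D.res_eq_zero i L h, (ones p).res_eq_zero i L h]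

theorem line_eval_zero (D : FlagData p ℂ) : D.line.map (evalRingHom 0) = D := by
  refine FlagData.ext ?_ ?_
  · ext L L'
    rw [map_mat, Matrix.map_apply]
    simp [line]
  · ext i L
    simp [line]

theorem line_eval_one (D : FlagData p ℂ) :
    D.line.map (evalRingHom 1) = (ones p).map (Nat.castRingHom ℂ) := by
  refine FlagData.ext ?_ ?_
  · ext L L'
    rw [map_mat, Matrix.map_apply]
    simp [line]
  · ext i L
    simp [line]

/-- Each extreme coefficient is a polynomial in `s`, nonzero at `s = 1`; genericity at that point is
not needed. -/
theorem eventually_coef_ne_zero (D : FlagData p ℂ) :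
    ∀ᶠ s in cofinite, ∀ (L : Loop p) (i : Fin n), L.Passes i →
      (D.line.map (evalRingHom s)).coef i (height i L - 1) L ≠ 0 := by
  refine eventually_all.2 fun L => eventually_all.2 fun i => ?_
  by_cases hi : L.Passes i
  · have h1 : (D.line.coef i (height i L - 1) L).eval 1 ≠ 0 := by
      rw [← coe_evalRingHom, ← coef_map, line_eval_one, coef_map]
      simpa using (ones_coef_pos hi).ne'
    filter_upwards [eventually_eval_ne_zero h1] with s hs _
    rwa [coef_map]
  · exact Eventually.of_forall fun s h => absurd h hi

theorem IsGeneric.compatible {D : FlagData p ℂ} {δ : Fin n → ℤ} (hD : D.IsGeneric δ)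
    (h : ∀ (L : Loop p) (i : Fin n), L.Passes i → D.coef i (height i L - 1) L ≠ 0) :
    Compatible (D.lattice δ) p := by
  have hy := hD.isPolarFlagBasis.isFlagBasis hD.hasTorus
  refine ⟨D.vec δ, hy, (hy.map_proj_ne_iff hD.hasTorus).2 fun L i hi => ?_⟩
  have := height_pos hi
  rw [show -δ i - (height i L : ℤ) = -δ i - 1 - (height i L - 1 : ℕ) by omega, vec_apply_pole]
  exact h L i hi

end FlagData

theorem dense_compatiblePiece {n : ℕ} (p : KostantPicture n) (lam : Fin n → ℤ) :
    Dense ((↑) ⁻¹' compatiblePiece p lam : Set (piece p lam)) := by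
  rw [dense_iff_inter_open]
  rintro _ ⟨U, hU, rfl⟩ ⟨⟨Y, hY⟩, hYU⟩
  obtain ⟨hT, hp⟩ := mem_piece_iff.1 hY
  obtain ⟨D, hD, rfl⟩ := FlagData.exists_lattice_eq hT hp
  generalize hδ : (fun i => lam i - (numLeft p i : ℤ)) = δ at *
  obtain ⟨N, d, e, he⟩ := FlagData.exists_isFrame_lattice p δ
  have hD0 : (D.line.map (evalRingHom 0)).IsGeneric δ := by rwa [D.line_eval_zero]
  have hgen := D.line.eventually_isGeneric δ hD0
  have hU' := eventually_mem_of_isFrame (a := 0)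
    (F := fun s => (D.line.map (evalRingHom s)).lattice δ)
    (fun s a => Sum.elim ((D.line.map (evalRingHom s)).vec δ) (fun q => Finsupp.single q.1 1) (e a))
    (fun a q => Sum.elim (fun L => D.line.entry δ L q)
      (fun q' => C (Finsupp.single q'.1 (1 : ℂ) q)) (e a))
    (fun s a q => by
      rcases e a with L | q'
      · simp only [Sum.elim_inl]
        rw [FlagData.vec_apply, FlagData.entry_map]
        rfl
      · simp)
    (he _ hD0.linearIndependent).1 (he _ hD0.linearIndependent).2
    (hgen.mono fun s hs => he _ hs.linearIndependent) hU
    (by rw [D.line_eval_zero]; exact hYU)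
  -- Cofinite sets of parameters have a common point because `ℂ` is infinite.
  obtain ⟨s, hs1, hs2, hs3⟩ := (hU'.and (hgen.and D.eventually_coef_ne_zero)).exists
  have hmem : (D.line.map (evalRingHom s)).lattice δ ∈ piece p lam :=
    mem_piece_iff.2 ⟨hδ ▸ hs2.hasTorus, hs2.loopCount_eq⟩
  exact ⟨⟨_, hmem⟩, hs1, hmem, hs2.compatible hs3⟩

end

end LoopGr

theorem mainTheorem10 (n : ℕ) (p : LoopGr.KostantPicture n) (lam : Fin n → ℤ) :
    IsOpen ((↑) ⁻¹' LoopGr.compatiblePiece p lam : Set (LoopGr.piece p lam)) ∧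
      Dense ((↑) ⁻¹' LoopGr.compatiblePiece p lam : Set (LoopGr.piece p lam)) := by
  exact ⟨LoopGr.isOpen_compatiblePiece p lam, LoopGr.dense_compatiblePiece p lam⟩
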